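/- **Setting.** An instance consists of a matroid $\mathcal M\subseteq 2^{[n]}$ and a prior distribution $\mathcal D_A\in\Delta(2^{[n]})$ of the set $A$ of active elements with $\Pr_{A\sim\mathcal D_A}[i\in A]>0$ for all $i\in[n]$; put $p_{\min}:=\min_{i\in[n]}\Pr_{A\sim\mathcal D_A}[i\in A]$. The prior is *$\alpha$-uncontentious* for $\mathcal M$ if there is a distribution $\mathcal D_\phi$ on the maps $\phi:2^{[n]}\to\mathcal M$ with $\phi(A)\subseteq A$ for all $A$, such that $\Pr_{A\sim\mathcal D_A,\,\phi\sim\mathcal D_\phi}[i\in\phi(A)\mid i\in A]\ge\alpha$ for all $i\in[n]$. An *online contention resolution scheme (OCRS) with preselected order* is a randomized algorithm that gets $n$, a membership oracle of $\mathcal M$, an oracle for independent samples of $\mathcal D_A$, and the number $\lceil 1/p_{\min}\rceil$. It first selects a (random) permutation $\pi$ of $[n]$. Then $A\sim\mathcal D_A$ is drawn, independently of everything before and unknown to the algorithm. Then, starting from $X=\emptyset$, in steps $i=1,\dots,n$ it is revealed whether $\pi(i)\in A$, and if $\pi(i)\in A$ and $X\cup\{\pi(i)\}\in\mathcal M$,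 then the algorithm decides immediately and irrevocably, possibly at random, whether to add $\pi(i)$ to $X$. The OCRS is *$(\alpha,\beta)$-universal* if for every $n$, every matroid $\mathcal M\subseteq2^{[n]}$ and every $\alpha$-uncontentious $\mathcal D_A$ for $\mathcal M$, the final set $X$ satisfies $\Pr[i\in X\mid i\in A]\ge\beta$ for all $i\in[n]$, the probability being over $A$, the samples, and the coins of the algorithm. Algorithms are programs (fixed for all $n$ and all instances) of a random-access machine on natural numbers with unit-cost addition, truncated subtraction, memory access, tests, loops, and coins of fixed biases. A sample of $\mathcal D_A$ takes time $t_{\mathcal D_A}\ge1$ and a membership query takes time $t_{\mathcal M}\ge1$, each on top of one unit step for the call. **Statement.** There is an absolute constant $C>0$ such that for all $\alpha,\varepsilon\in(0,1]$ there is an $\bigl(\alpha,\frac{(1-\varepsilon)\alpha^2}{4}\bigr)$-universal OCRS with preselected order which, for every $n\ge1$, every matroid $\mathcal M\subseteq 2^{[n]}$, every $\alpha$-uncontentious prior $\mathcal D_A$ for $\mathcal M$, and all integers $t_{\mathcal D_A},t_{\mathcal M}\ge 1$, always runs in time at most $$C\cdot\frac{n\log(2n/\varepsilon)}{\alpha^2\varepsilon^2p_{\min}}\cdot\bigl(t_{\mathcal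 D_A}+n\cdot t_{\mathcal M}\bigr).$$ (For $n\ge2$ the logarithm is $\Theta(\log(n/\varepsilon))$.) -/

import Mathlib

noncomputable section

namespace OCRS

/-! ### Probabilities for discrete distributions -/

/-- The probability of the event `S` under `p`, as a real number. -/
def prob {Ω : Type} (p : PMF Ω) (S : Set Ω) : ℝ := (p.toOuterMeasure S).toReal

/-- The conditional probability of `S` given `T`. It is only used when `T` has positive
probability. -/
def condProb {Ω : Type} (p : PMF Ω) (S T : Set Ω) : ℝ := prob p (S ∩ T) / prob p T

/-! ### Instances, contention resolution schemes and uncontentious distributions -/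

/-- A matroid on the ground set `[n]` together with a prior distribution of the set of active
elements, under which every element is active with positive probability. -/
structure Instance (n : ℕ) where
  M : Matroid (Fin n)
  ground : M.E = Set.univ
  D : PMF (Finset (Fin n))
  pos : ∀ i, 0 < prob D {A | i ∈ A}

/-- The smallest probability with which an element is active (for `0 < n`, a minimum over a
nonempty finite set). -/
def Instance.pMin {n : ℕ} (I : Instance n) : ℝ := ⨅ i, prob I.D {A | i ∈ A}

/-- For a joint distribution `J` of the active set `A` and the selected set `X`: every element
that is active with positive probability is selected with probability at least `β`
conditioned on being active. -/
def IsBalanced {n : ℕ} (J : PMF (Finset (Fin n) × Finset (Fin n))) (β : ℝ) : Prop :=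
  ∀ i, 0 < prob J {ω | i ∈ ω.1} → β ≤ condProb J {ω | i ∈ ω.2} {ω | i ∈ ω.1}

/-- The maps that send an active set to an independent subset of it. -/
abbrev SelectionMap {n : ℕ} (M : Matroid (Fin n)) : Type :=
  {φ : Finset (Fin n) → Finset (Fin n) // ∀ A, φ A ⊆ A ∧ M.Indep (φ A : Set (Fin n))}

/-- The joint law of `(A, φ A)` for independent `A` and `φ`. -/
def crsLaw {n : ℕ} {M : Matroid (Fin n)} (D : PMF (Finset (Fin n)))
    (Dφ : PMF (SelectionMap M)) : PMF (Finset (Fin n) × Finset (Fin n)) :=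
  D.bind fun A => Dφ.map fun φ => (A, φ.1 A)

/-- The prior is `α`-uncontentious for the matroid: some (offline, randomized) contention
resolution scheme is `α`-balanced. -/
def Instance.Uncontentious {n : ℕ} (I : Instance n) (α : ℝ) : Prop :=
  ∃ Dφ : PMF (SelectionMap I.M), IsBalanced (crsLaw I.D Dφ) α

/-! ### The machine model

A randomized random-access machine over the natural numbers with registers and arrays, addition,
truncated subtraction, tests for zero, bounded loops, biased coins, and the two oracles. A
program is a fixed finite text, which does not depend on `n` or on the instance. Every operation
costs one step; a call of an oracle costs in addition the time of that oracle. -/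

/-- The memory: registers and arrays, which hold natural numbers. -/
structure Store where
  reg : ℕ → ℕ
  arr : ℕ → ℕ → ℕ

def Store.setReg (s : Store) (x v : ℕ) : Store :=
  { s with reg := Function.update s.reg x v }

def Store.setCell (s : Store) (a i v : ℕ) : Store :=
  { s with arr := Function.update s.arr a (Function.update (s.arr a) i v) }

def Store.setArr (s : Store) (a : ℕ) (f : ℕ → ℕ) : Store :=
  { s with arr := Function.update s.arr a f }

/-- Arithmetic expressions; `get a e` reads the cell of array `a` whose index is the value
of `e`. -/
inductive Expr where
  | const (k : ℕ)
  | reg (x : ℕ)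
  | get (a : ℕ) (e : Expr)
  | add (e₁ e₂ : Expr)
  | sub (e₁ e₂ : Expr)

def Expr.eval (s : Store) : Expr → ℕ
  | .const k => k
  | .reg x => s.reg x
  | .get a e => s.arr a (e.eval s)
  | .add e₁ e₂ => e₁.eval s + e₂.eval s
  | .sub e₁ e₂ => e₁.eval s - e₂.eval s

/-- The number of operations in the evaluation of an expression. -/
def Expr.size : Expr → ℕ
  | .const _ => 1
  | .reg _ => 1
  | .get _ e => e.size + 1
  | .add e₁ e₂ => e₁.size + e₂.size + 1
  | .sub e₁ e₂ => e₁.size + e₂.size + 1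

/-- Programs.
* `assign x e`: put the value of `e` into register `x`.
* `store a i e`: put the value of `e` into the cell of array `a` with index the value of `i`.
* `cond e c₁ c₂`: run `c₁` if the value of `e` is not zero, and `c₂` otherwise.
* `loop x e c`: run `c` with register `x` set to `0, 1, …, N - 1` in turn, where `N` is the value
  of `e` at the start.
* `coin x q`: set register `x` to `1` with probability `q`, and to `0` otherwise.
* `sample a`: write the indicator vector of a fresh sample of the prior into array `a`.
* `member x a`: set register `x` to `1` if the set with indicator vector in array `a` is
  independent in the matroid, and to `0` otherwise. -/
inductive Prog where
  | skip
  | assign (x : ℕ) (e : Expr)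
  | store (a : ℕ) (i e : Expr)
  | seq (c₁ c₂ : Prog)
  | cond (e : Expr) (c₁ c₂ : Prog)
  | loop (x : ℕ) (e : Expr) (c : Prog)
  | coin (x : ℕ) (q : unitInterval)
  | sample (a : ℕ)
  | member (x a : ℕ)

/-- What an execution uses: elementary steps, samples of the prior, and queries of the
membership oracle. -/
@[ext]
structure Cost where
  steps : ℕ
  samples : ℕ
  queries : ℕ

instance : Zero Cost := ⟨⟨0, 0, 0⟩⟩

instance : Add Cost :=
  ⟨fun a b => ⟨a.steps + b.steps, a.samples + b.samples, a.queries + b.queries⟩⟩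

/-- `k` elementary steps. -/
def Cost.ofSteps (k : ℕ) : Cost := ⟨k, 0, 0⟩

/-- The running time when a sample takes time `tD` and a membership query takes time `tM`. -/
def Cost.time (c : Cost) (tD tM : ℕ) : ℕ := c.steps + c.samples * tD + c.queries * tM

/-- The indicator vector of a set of elements, as the contents of an array. -/
def indicator {n : ℕ} (A : Finset (Fin n)) (j : ℕ) : ℕ :=
  open Classical in if ∃ i ∈ A, (i : ℕ) = j then 1 else 0

/-- The set of elements whose indicator vector is in array `a`. -/
def Store.setOf (s : Store) (n a : ℕ) : Finset (Fin n) :=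
  Finset.univ.filter fun i => s.arr a i ≠ 0

/-- A coin that shows `true` with probability `q`. -/
def biasedCoin (q : unitInterval) : PMF Bool :=
  PMF.ofFintype (fun b => if b then ENNReal.ofReal q else ENNReal.ofReal (1 - q)) (by
    rw [Fintype.sum_bool]
    simp only [if_true, Bool.false_eq_true, if_false]
    rw [← ENNReal.ofReal_add q.2.1 (sub_nonneg.2 q.2.2)]
    simp)

/-- Run `body` for `x = 0, …, k - 1`; every round costs one additional step. -/
def loopRun (body : Store → PMF (Store × Cost)) (x : ℕ) : ℕ → Store → PMF (Store × Cost)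
  | 0, s => PMF.pure (s, 0)
  | k + 1, s =>
    (loopRun body x k s).bind fun r =>
      (body (r.1.setReg x k)).map fun r' => (r'.1, r.2 + r'.2 + Cost.ofSteps 1)

/-- The law of the final memory and of the cost of a program started in memory `s`. -/
def Prog.run {n : ℕ} (J : Instance n) : Prog → Store → PMF (Store × Cost)
  | .skip, s => PMF.pure (s, Cost.ofSteps 1)
  | .assign x e, s => PMF.pure (s.setReg x (e.eval s), Cost.ofSteps (e.size + 1))
  | .store a i e, s =>
    PMF.pure (s.setCell a (i.eval s) (e.eval s), Cost.ofSteps (i.size + e.size + 1))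
  | .seq c₁ c₂, s =>
    (c₁.run J s).bind fun r => (c₂.run J r.1).map fun r' => (r'.1, r.2 + r'.2)
  | .cond e c₁ c₂, s =>
    (if e.eval s ≠ 0 then c₁.run J s else c₂.run J s).map
      fun r => (r.1, Cost.ofSteps (e.size + 1) + r.2)
  | .loop x e c, s =>
    (loopRun (c.run J) x (e.eval s) s).map fun r => (r.1, Cost.ofSteps (e.size + 1) + r.2)
  | .coin x q, s =>
    (biasedCoin q).map fun b => (s.setReg x (if b then 1 else 0), Cost.ofSteps 1)
  | .sample a, s => J.D.map fun A => (s.setArr a (indicator A), ⟨1, 1, 0⟩)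
  | .member x a, s =>
    open Classical in
    PMF.pure (s.setReg x (if J.M.Indep (s.setOf n a : Set (Fin n)) then 1 else 0), ⟨1, 0, 1⟩)

/-! ### Online contention resolution schemes with preselected order -/

/-- The initial memory: register `0` holds `n`, register `1` holds `1 / pMin` rounded up, and all
other cells hold `0`. -/
def Instance.input {n : ℕ} (J : Instance n) : Store where
  reg := fun x => if x = 0 then n else if x = 1 then ⌈1 / J.pMin⌉₊ else 0
  arr := fun _ _ => 0

/-- `σ` is the arrival order that is stored in array `0`: its cell `i` holds the `i`-th element. -/
def Store.HoldsOrder {n : ℕ} (s : Store) (σ : Equiv.Perm (Fin n)) : Prop :=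
  ∀ i : Fin n, s.arr 0 i = (σ i : ℕ)

/-- An online contention resolution scheme with preselected order. The program `select` is run
first and always leaves a permutation in array `0`. The program `decide` is run whenever an
element arrives. Both have access to the two oracles and share their memory. -/
structure Preselected where
  select : Prog
  decide : Prog
  order : ∀ (n : ℕ) (J : Instance n), ∀ r ∈ (select.run J J.input).support,
    ∃ σ : Equiv.Perm (Fin n), r.1.HoldsOrder σ

/-- What is revealed at the arrival of `e`: register `2` receives the element, register `3` tells
whether it is active, and register `4` whether it is selectable. -/
def Store.reveal (s : Store) (e : ℕ) (active selectable : Prop) : Store :=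
  open Classical in
  ((s.setReg 2 e).setReg 3 (if active then 1 else 0)).setReg 4 (if selectable then 1 else 0)

/-- The arrivals of the elements of a list, in this order, when `X` has been selected so far. At
each arrival the activity of the element is revealed, it is tested with one membership query
(which is charged) whether the element is selectable, and `decide` is run. A selectable element is
then added to the selected set, irrevocably, if and only if register `5` is not zero. -/
def online {n : ℕ} (J : Instance n) (decide : Prog) (A : Finset (Fin n)) :
    List (Fin n) → Store → Finset (Fin n) → PMF (Finset (Fin n) × Cost)
  | [], _, X => PMF.pure (X, 0)
  | e :: l, s, X =>
    open Classical in
    (decide.run J (s.reveal e (e ∈ A) (e ∈ A ∧ J.M.Indep (insert e X : Finset (Fin n))))).bind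
      fun r =>
        (online J decide A l r.1
          (if (e ∈ A ∧ J.M.Indep (insert e X : Finset (Fin n))) ∧ r.1.reg 5 ≠ 0
            then insert e X else X)).map
          fun q => (q.1, ⟨1, 0, 1⟩ + r.2 + q.2)

/-- The law of the active set, the selected set and the total cost: first the order is selected,
then the active set is sampled (independently of everything before), then the elements arrive in
the selected order. -/
def Preselected.run (alg : Preselected) {n : ℕ} (J : Instance n) :
    PMF (Finset (Fin n) × Finset (Fin n) × Cost) :=
  open Classical in
  (alg.select.run J J.input).bind fun r =>
    J.D.bind fun A =>
      if h : ∃ σ : Equiv.Perm (Fin n), r.1.HoldsOrder σ then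
        (online J alg.decide A ((List.finRange n).map h.choose) r.1 ∅).map
          fun q => (A, q.1, r.2 + q.2)
      else PMF.pure (A, ∅, r.2)  -- never happens, by the field `order`

/-- The scheme is `β`-balanced for the instance. -/
def Preselected.BalancedFor (alg : Preselected) {n : ℕ} (J : Instance n) (β : ℝ) : Prop :=
  IsBalanced ((alg.run J).map fun ω => (ω.1, ω.2.1)) β

/-- The scheme is `(α, β)`-universal: it is `β`-balanced for every matroid and every prior that is
`α`-uncontentious for it. -/
def Preselected.IsUniversal (alg : Preselected) (α β : ℝ) : Prop :=
  ∀ (n : ℕ) (J : Instance n), J.Uncontentious α → alg.BalancedFor J β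

/-- Every execution of the scheme on the instance takes time at most `T`, when a sample takes time
`tD` and a membership query takes time `tM`. -/
def Preselected.RunsInTime (alg : Preselected) {n : ℕ} (J : Instance n) (tD tM : ℕ) (T : ℝ) :
    Prop :=
  ∀ ω ∈ (alg.run J).support, (ω.2.2.time tD tM : ℝ) ≤ T

end OCRS

end

/-!
# Online contention resolution with preselected order

**The order.** Let `q = α / 2`. An element that can be selected when it arrives is selected with
probability `q`. The selected set is then a greedily chosen basis of a `q`-subsample of the active
elements that have arrived (`mean_greedyLaw_closure`), so an active element `e` is selected with
probability at least `q` times the probability that a subsample `B` of the earlier active elements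
does not span `e` (`le_mean_greedyLaw_mem`). A good order is built from the back. Let `S` be the set
of elements without a position, and let `I ⊆ A ∩ S` be the part in `S` of the set that an
`α`-balanced offline scheme selects. Since `B` spans at most `|B|` elements of the independent set
`I`, at least `|I| - |B|` active elements of `S` are not spanned; in expectation this is at least
`α - q = α / 2` times the expected number of active elements of `S`. Hence some `e ∈ S` is unspanned
with conditional probability at least `α / 2` given that it is active (`exists_le_freeProb`), and
such an element may come last in `S`. Altogether every element is selected with probability at least
`q * α / 2 = α² / 4` given that it is active.

**Sampling.** The conditional probabilities are compared with a rational threshold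
`τ = c₂ / (c₁ + c₂)` slightly below `α / 2`: in every sample an active element of `S` gains `c₁` if
it is unspanned, and loses `c₂` otherwise, and any element whose gains are at least its losses is
chosen, which takes no multiplication on the machine. The sign of the expected score tells whether
the conditional probability exceeds `τ`, and exponential moments (`mean_scoreLaw_potential_le`) show
that `O(log (n / ε) / (α² ε² p_min))` samples per position make all `n` choices good except with
probability `ε / 2` (`mean_pick_bad_le`, `failure_le`). Each sample costs `2 n` membership queries.

**The program.** The selected order, the samples and the online phase are first described as
discrete laws on lists and finite sets (`orderLaw`, `jointLaw`). A program *simulates* such a law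
(`Sim`) if the outcome of the law and the final memory of the program can be coupled such that they
correspond to each other and every execution stays within a time bound. This relation is
compositional in the program (`Sim.seq`, `Sim.loop`), and it transfers at once the balance and the
running time to the machine (`coupled_run`).
-/

noncomputable section

namespace OCRS

open scoped ENNReal

/-! ### Means and couplings of discrete distributions -/

/-- The expectation of a nonnegative function under a discrete distribution. -/
def mean {X : Type} (p : PMF X) (f : X → ℝ≥0∞) : ℝ≥0∞ := ∑' x, p x * f x

section Mean

variable {X Y : Type}

theorem mean_pure (x : X) (f : X → ℝ≥0∞) : mean (PMF.pure x) f = f x := by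
  unfold mean
  rw [tsum_eq_single x]
  · simp [PMF.pure_apply]
  · intro y hy
    simp [PMF.pure_apply, hy]

theorem mean_bind (p : PMF X) (q : X → PMF Y) (f : Y → ℝ≥0∞) :
    mean (p.bind q) f = mean p fun x => mean (q x) f := by
  unfold mean
  simp only [PMF.bind_apply, ← ENNReal.tsum_mul_right, ← ENNReal.tsum_mul_left]
  rw [ENNReal.tsum_comm]
  simp only [mul_assoc]

theorem mean_map (p : PMF X) (g : X → Y) (f : Y → ℝ≥0∞) :
    mean (p.map g) f = mean p fun x => f (g x) := by
  rw [← PMF.bind_pure_comp, mean_bind]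
  simp [mean_pure]

theorem mean_mono_support {p : PMF X} {f g : X → ℝ≥0∞} (h : ∀ x ∈ p.support, f x ≤ g x) :
    mean p f ≤ mean p g := by
  refine ENNReal.tsum_le_tsum fun x => ?_
  by_cases hx : x ∈ p.support
  · gcongr
    exact h x hx
  · simp [(PMF.apply_eq_zero_iff p x).2 hx]

theorem mean_mono {p : PMF X} {f g : X → ℝ≥0∞} (h : ∀ x, f x ≤ g x) : mean p f ≤ mean p g :=
  mean_mono_support fun x _ => h x

theorem mean_add (p : PMF X) (f g : X → ℝ≥0∞) :
    (mean p fun x => f x + g x) = mean p f + mean p g := by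
  simp only [mean, mul_add, ENNReal.tsum_add]

theorem mean_const_mul (p : PMF X) (c : ℝ≥0∞) (f : X → ℝ≥0∞) :
    (mean p fun x => c * f x) = c * mean p f := by
  simp only [mean, ← ENNReal.tsum_mul_left]
  exact tsum_congr fun x => mul_left_comm _ _ _

theorem mean_const (p : PMF X) (c : ℝ≥0∞) : (mean p fun _ => c) = c := by
  simp only [mean, ENNReal.tsum_mul_right, PMF.tsum_coe, one_mul]

theorem mean_sum {ι : Type} (p : PMF X) (s : Finset ι) (f : ι → X → ℝ≥0∞) :
    (mean p fun x => ∑ i ∈ s, f i x) = ∑ i ∈ s, mean p (f i) := by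
  classical
  induction s using Finset.induction_on with
  | empty => simp [mean]
  | insert a s ha ih => simp only [Finset.sum_insert ha, mean_add, ih]

theorem mean_ite (p : PMF X) (E : X → Prop) [DecidablePred E] :
    (mean p fun x => if E x then 1 else 0) = p.toOuterMeasure {x | E x} := by
  classical
  simp [mean, PMF.toOuterMeasure_apply, Set.indicator_apply]

theorem toReal_mean_ite (p : PMF X) (E : X → Prop) [DecidablePred E] :
    (mean p fun x => if E x then 1 else 0).toReal = prob p {x | E x} := by
  rw [mean_ite, prob]

theorem toOuterMeasure_le_one (p : PMF X) (s : Set X) : p.toOuterMeasure s ≤ 1 := by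
  classical
  rw [PMF.toOuterMeasure_apply, ← p.tsum_coe]
  exact ENNReal.tsum_le_tsum fun x => Set.indicator_le_self _ _ x

theorem ofReal_prob (p : PMF X) (s : Set X) : ENNReal.ofReal (prob p s) = p.toOuterMeasure s :=
  ENNReal.ofReal_toReal (ne_top_of_le_ne_top ENNReal.one_ne_top (toOuterMeasure_le_one p s))

theorem mean_biasedCoin (q : unitInterval) (f : Bool → ℝ≥0∞) :
    mean (biasedCoin q) f =
      ENNReal.ofReal q * f true + ENNReal.ofReal (1 - q) * f false := by
  simp [mean, biasedCoin, tsum_fintype]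

end Mean

/-- `p` and `μ` have a coupling that is concentrated on the relation `R`. -/
def Coupled {X Y : Type} (p : PMF X) (μ : PMF Y) (R : X → Y → Prop) : Prop :=
  ∃ γ : PMF (X × Y), γ.map Prod.fst = p ∧ γ.map Prod.snd = μ ∧ ∀ z ∈ γ.support, R z.1 z.2

namespace Coupled

variable {X Y X' Y' : Type} {p : PMF X} {μ : PMF Y} {R : X → Y → Prop}

theorem pure {x : X} {y : Y} (h : R x y) : Coupled (PMF.pure x) (PMF.pure y) R :=
  ⟨PMF.pure (x, y), PMF.pure_map _ _, PMF.pure_map _ _, by simpa using h⟩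

theorem mono {R' : X → Y → Prop} (h : Coupled p μ R) (hR : ∀ x y, R x y → R' x y) :
    Coupled p μ R' := by
  obtain ⟨γ, h1, h2, h3⟩ := h
  exact ⟨γ, h1, h2, fun z hz => hR _ _ (h3 z hz)⟩

theorem bind {f : X → PMF X'} {g : Y → PMF Y'} {R' : X' → Y' → Prop} (h : Coupled p μ R)
    (hfg : ∀ x y, R x y → Coupled (f x) (g y) R') : Coupled (p.bind f) (μ.bind g) R' := by
  obtain ⟨γ, h1, h2, h3⟩ := h
  -- off the relation `R`, which carries all the mass, the product coupling is used
  have key : ∀ z : X × Y, ∃ κ : PMF (X' × Y'), κ.map Prod.fst = f z.1 ∧ κ.map Prod.snd = g z.2 ∧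
      (R z.1 z.2 → ∀ w ∈ κ.support, R' w.1 w.2) := by
    intro z
    by_cases hz : R z.1 z.2
    · obtain ⟨κ, a, b, c⟩ := hfg _ _ hz
      exact ⟨κ, a, b, fun _ => c⟩
    · refine ⟨(f z.1).bind fun a => (g z.2).map fun b => (a, b), ?_, ?_, fun h => absurd h hz⟩
      · have hc : ∀ a : X', PMF.map (fun _ => a) (g z.2) = PMF.pure a := fun a => PMF.map_const _ _
        simp [PMF.map_bind, PMF.map_comp, Function.comp_def, hc]
      · simp [PMF.map_bind, PMF.map_comp, Function.comp_def]
        exact PMF.map_id _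
  choose κ k1 k2 k3 using key
  refine ⟨γ.bind κ, ?_, ?_, ?_⟩
  · rw [PMF.map_bind, ← h1, PMF.bind_map]
    simp [k1, Function.comp_def]
  · rw [PMF.map_bind, ← h2, PMF.bind_map]
    simp [k2, Function.comp_def]
  · intro w hw
    obtain ⟨z, hz, hw⟩ := (PMF.mem_support_bind_iff _ _ _).1 hw
    exact k3 z (h3 z hz) w hw

theorem map {f : X → X'} {g : Y → Y'} {R' : X' → Y' → Prop} (h : Coupled p μ R)
    (hfg : ∀ x y, R x y → R' (f x) (g y)) : Coupled (p.map f) (μ.map g) R' := by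
  rw [← PMF.bind_pure_comp, ← PMF.bind_pure_comp]
  exact h.bind fun x y hxy => Coupled.pure (hfg x y hxy)

theorem map_right {g : Y → Y'} {R' : X → Y' → Prop} (h : Coupled p μ R)
    (hfg : ∀ x y, R x y → R' x (g y)) : Coupled p (μ.map g) R' := by
  have := h.map (f := id) hfg
  rwa [PMF.map_id] at this

theorem refl (p : PMF X) : Coupled p p Eq :=
  ⟨p.map fun x => (x, x), by simp [PMF.map_comp, Function.comp_def]; exact PMF.map_id _,
    by simp [PMF.map_comp, Function.comp_def]; exact PMF.map_id _, by
      intro z hz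
      obtain ⟨x, -, rfl⟩ := (PMF.mem_support_map_iff _ _ _).1 hz
      rfl⟩

theorem exists_of_mem_support (h : Coupled p μ R) {y : Y} (hy : y ∈ μ.support) :
    ∃ x ∈ p.support, R x y := by
  obtain ⟨γ, h1, h2, h3⟩ := h
  rw [← h2] at hy
  obtain ⟨z, hz, rfl⟩ := (PMF.mem_support_map_iff _ _ _).1 hy
  refine ⟨z.1, ?_, h3 z hz⟩
  rw [← h1]
  exact (PMF.mem_support_map_iff _ _ _).2 ⟨z, hz, rfl⟩

end Coupled

/-! ### Subsampling a finite set -/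

/-- The expectation of `f B` when `B ⊆ T` contains each element of `T` independently with
probability `q`. -/
def subsetMean {ι : Type} (q : unitInterval) (T : Finset ι) (f : Finset ι → ℝ≥0∞) : ℝ≥0∞ :=
  ∑ B ∈ T.powerset,
    ENNReal.ofReal q ^ B.card * ENNReal.ofReal (1 - q) ^ (T.card - B.card) * f B

theorem ofReal_add_ofReal_one_sub (q : unitInterval) :
    ENNReal.ofReal q + ENNReal.ofReal (1 - q) = 1 := by
  rw [← ENNReal.ofReal_add q.2.1 (sub_nonneg.2 q.2.2)]
  simp

section SubsetMean

variable {ι : Type} (q : unitInterval) (T : Finset ι)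

theorem subsetMean_empty (f : Finset ι → ℝ≥0∞) : subsetMean q ∅ f = f ∅ := by
  simp [subsetMean]

variable {T} in
theorem subsetMean_insert [DecidableEq ι] {e : ι} (he : e ∉ T) (f : Finset ι → ℝ≥0∞) :
    subsetMean q (insert e T) f =
      ENNReal.ofReal q * subsetMean q T (fun B => f (insert e B)) +
        ENNReal.ofReal (1 - q) * subsetMean q T f := by
  unfold subsetMean
  rw [Finset.sum_powerset_insert he, add_comm, Finset.mul_sum, Finset.mul_sum]
  congr 1
  · refine Finset.sum_congr rfl fun B hB => ?_
    have hB' := Finset.mem_powerset.1 hB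
    rw [Finset.card_insert_of_notMem fun h => he (hB' h), Finset.card_insert_of_notMem he,
      Nat.add_sub_add_right, pow_succ]
    ring
  · refine Finset.sum_congr rfl fun B hB => ?_
    have := Finset.card_le_card (Finset.mem_powerset.1 hB)
    rw [Finset.card_insert_of_notMem he, Nat.succ_sub this, pow_succ]
    ring

theorem subsetMean_mono {f g : Finset ι → ℝ≥0∞} (h : ∀ B ⊆ T, f B ≤ g B) :
    subsetMean q T f ≤ subsetMean q T g :=
  Finset.sum_le_sum fun B hB => by
    gcongr
    exact h B (Finset.mem_powerset.1 hB)

theorem subsetMean_congr {f g : Finset ι → ℝ≥0∞} (h : ∀ B ⊆ T, f B = g B) :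
    subsetMean q T f = subsetMean q T g :=
  Finset.sum_congr rfl fun B hB => by rw [h B (Finset.mem_powerset.1 hB)]

theorem subsetMean_add (f g : Finset ι → ℝ≥0∞) :
    (subsetMean q T fun B => f B + g B) = subsetMean q T f + subsetMean q T g := by
  simp only [subsetMean, mul_add, Finset.sum_add_distrib]

theorem subsetMean_sum {κ : Type} (s : Finset κ) (f : κ → Finset ι → ℝ≥0∞) :
    (subsetMean q T fun B => ∑ i ∈ s, f i B) = ∑ i ∈ s, subsetMean q T (f i) := by
  simp only [subsetMean, Finset.mul_sum]
  exact Finset.sum_comm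

theorem subsetMean_const (c : ℝ≥0∞) : (subsetMean q T fun _ => c) = c := by
  classical
  induction T using Finset.induction_on with
  | empty => exact subsetMean_empty q _
  | insert e T he ih => rw [subsetMean_insert q he, ih, ← add_mul, ofReal_add_ofReal_one_sub, one_mul]

theorem subsetMean_card :
    (subsetMean q T fun B => (B.card : ℝ≥0∞)) = ENNReal.ofReal q * T.card := by
  classical
  induction T using Finset.induction_on with
  | empty => simp [subsetMean_empty]
  | insert e T he ih =>
    have h : (subsetMean q T fun B => ((insert e B).card : ℝ≥0∞)) =
        subsetMean q T fun B => (B.card : ℝ≥0∞) + 1 :=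
      subsetMean_congr q T fun B hB => by
        rw [Finset.card_insert_of_notMem fun h => he (hB h)]
        push_cast
        rfl
    rw [subsetMean_insert q he, h, subsetMean_add, subsetMean_const, ih,
      Finset.card_insert_of_notMem he]
    push_cast
    calc _ = (ENNReal.ofReal q + ENNReal.ofReal (1 - q)) * (ENNReal.ofReal q * T.card)
          + ENNReal.ofReal q := by ring
      _ = _ := by rw [ofReal_add_ofReal_one_sub]; ring

end SubsetMean

/-! ### The greedy selection with coins -/

section Greedy

variable {n : ℕ} (M : Matroid (Fin n)) (q : unitInterval) (T : Finset (Fin n))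

open Classical in
/-- One arrival: if `e` belongs to `T`, can be added to `X`, and a coin of bias `q` agrees, then it
is added. -/
def greedyStep (e : Fin n) (X : Finset (Fin n)) : PMF (Finset (Fin n)) :=
  (biasedCoin q).map fun b =>
    if b = true ∧ e ∈ T ∧ M.Indep (insert e X : Finset (Fin n)) then insert e X else X

/-- The law of the set that is selected from `T`, starting from `X`, when the elements of a list
arrive one by one. -/
def greedyLaw : List (Fin n) → Finset (Fin n) → PMF (Finset (Fin n))
  | [], X => PMF.pure X
  | e :: l, X => (greedyStep M q T e X).bind (greedyLaw l)

theorem greedyLaw_append (l₁ l₂ : List (Fin n)) (X : Finset (Fin n)) :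
    greedyLaw M q T (l₁ ++ l₂) X = (greedyLaw M q T l₁ X).bind (greedyLaw M q T l₂) := by
  induction l₁ generalizing X with
  | nil => simp [greedyLaw]
  | cons e l ih => 
    simp only [List.cons_append, greedyLaw, PMF.bind_bind]
    congr 1
    funext Y
    exact ih Y

theorem greedyLaw_concat (l : List (Fin n)) (e : Fin n) (X : Finset (Fin n)) :
    greedyLaw M q T (l ++ [e]) X = (greedyLaw M q T l X).bind (greedyStep M q T e) := by
  rw [greedyLaw_append]
  congr 1
  funext Y
  simp [greedyLaw]

open Classical in
theorem mean_greedyStep (e : Fin n) (X : Finset (Fin n)) (f : Finset (Fin n) → ℝ≥0∞) :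
    mean (greedyStep M q T e X) f =
      ENNReal.ofReal q *
        f (if e ∈ T ∧ M.Indep (insert e X : Finset (Fin n)) then insert e X else X) +
        ENNReal.ofReal (1 - q) * f X := by
  rw [greedyStep, mean_map, mean_biasedCoin]
  simp

theorem mem_support_greedyStep {e : Fin n} {X Y : Finset (Fin n)}
    (h : Y ∈ (greedyStep M q T e X).support) :
    Y = X ∨ Y = insert e X ∧ e ∈ T ∧ M.Indep (Y : Set (Fin n)) := by
  obtain ⟨b, -, rfl⟩ := (PMF.mem_support_map_iff _ _ _).1 h
  split_ifs with hb
  · exact Or.inr ⟨rfl, hb.2⟩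
  · exact Or.inl rfl

theorem support_greedyLaw {l : List (Fin n)} {X Y : Finset (Fin n)}
    (h : Y ∈ (greedyLaw M q T l X).support) (hX : M.Indep (X : Set (Fin n))) :
    X ⊆ Y ∧ (∀ i ∈ Y, i ∈ X ∨ i ∈ l) ∧ M.Indep (Y : Set (Fin n)) := by
  induction l generalizing X with
  | nil =>
    rw [greedyLaw, PMF.support_pure, Set.mem_singleton_iff] at h
    subst h
    exact ⟨subset_rfl, fun i hi => Or.inl hi, hX⟩
  | cons e l ih =>
    rw [greedyLaw] at h
    obtain ⟨Z, hZ, hY⟩ := (PMF.mem_support_bind_iff _ _ _).1 h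
    rcases mem_support_greedyStep M q T hZ with rfl | ⟨rfl, -, hi⟩
    · obtain ⟨h1, h2, h3⟩ := ih hY hX
      exact ⟨h1, fun i hi => (h2 i hi).imp_right (List.mem_cons_of_mem _), h3⟩
    · obtain ⟨h1, h2, h3⟩ := ih hY hi
      refine ⟨(Finset.subset_insert _ _).trans h1, fun i hi => ?_, h3⟩
      have := h2 i hi
      simp only [Finset.mem_insert, List.mem_cons] at this ⊢
      tauto

/-- The greedily selected set spans exactly what the subsampled set spans. In particular the law of
its span does not depend on the order of arrival. -/
theorem mean_greedyLaw_closure (hM : M.E = Set.univ) (f : Set (Fin n) → ℝ≥0∞)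
    {l : List (Fin n)} (hl : l.Nodup) {X : Finset (Fin n)} (hX : M.Indep (X : Set (Fin n))) :
    (mean (greedyLaw M q T l X) fun Y => f (M.closure Y)) =
      subsetMean q (l.toFinset ∩ T) fun B => f (M.closure (B ∪ X)) := by
  classical
  induction l generalizing X with
  | nil => simp [greedyLaw, mean_pure, subsetMean_empty]
  | cons e l ih =>
    have hel : e ∉ l := (List.nodup_cons.1 hl).1
    rw [greedyLaw, mean_bind, mean_greedyStep, ih (List.nodup_cons.1 hl).2 hX]
    by_cases heT : e ∈ T
    · have h1 : (e :: l).toFinset ∩ T = insert e (l.toFinset ∩ T) := by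
        rw [List.toFinset_cons, Finset.insert_inter_of_mem heT]
      rw [h1, subsetMean_insert q (by simp [hel])]
      congr 2
      by_cases hi : M.Indep (insert e X : Finset (Fin n))
      · rw [if_pos ⟨heT, hi⟩, ih (List.nodup_cons.1 hl).2 hi]
        congr 1
        funext B
        congr 2
        push_cast
        rw [Set.union_insert, Set.insert_union]
      · rw [if_neg fun h => hi h.2, ih (List.nodup_cons.1 hl).2 hX]
        congr 1
        funext B
        congr 1
        have he : e ∈ M.closure X := by
          by_contra h
          rw [hX.notMem_closure_iff (by rw [hM]; trivial)] at h
          exact hi (by push_cast; exact h.1)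
        push_cast
        rw [Set.insert_union, Matroid.closure_insert_eq_of_mem_closure]
        exact M.closure_subset_closure Set.subset_union_right he
    · have h1 : (e :: l).toFinset ∩ T = l.toFinset ∩ T := by
        rw [List.toFinset_cons, Finset.insert_inter_of_notMem heT]
      rw [if_neg fun h => heT h.1, ih (List.nodup_cons.1 hl).2 hX, h1, ← add_mul,
        ofReal_add_ofReal_one_sub, one_mul]

open Classical in
/-- The probability that `e` is not spanned by a subsample of `T`. -/
def unspanned (e : Fin n) : ℝ≥0∞ :=
  subsetMean q T fun B => if e ∈ M.closure B then 0 else 1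

theorem unspanned_le_one (e : Fin n) : unspanned M q T e ≤ 1 := by
  rw [← subsetMean_const q T 1]
  exact subsetMean_mono q T fun B _ => by split_ifs <;> simp

open Classical in
/-- An element is selected at least if its coin agrees and the earlier arrivals do not span it. -/
theorem le_mean_greedyLaw_mem (hM : M.E = Set.univ) {l₁ l₂ : List (Fin n)} {e : Fin n}
    (hl : l₁.Nodup) (he : e ∈ T) :
    ENNReal.ofReal q * unspanned M q (l₁.toFinset ∩ T) e ≤
      mean (greedyLaw M q T (l₁ ++ e :: l₂) ∅) fun Y => if e ∈ Y then 1 else 0 := by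
  have hmem : ∀ X : Finset (Fin n), M.Indep (X : Set (Fin n)) → e ∈ X →
      1 ≤ mean (greedyLaw M q T l₂ X) fun Y => if e ∈ Y then 1 else 0 := by
    intro X hX heX
    refine (mean_const (greedyLaw M q T l₂ X) 1).symm.le.trans ?_
    exact mean_mono_support fun Y hY => by
      rw [if_pos ((support_greedyLaw M q T hY hX).1 heX)]
  have h0 : M.Indep ((∅ : Finset (Fin n)) : Set (Fin n)) := by simp
  have key := mean_greedyLaw_closure M q T hM (fun F => if e ∈ F then 0 else 1) hl h0
  simp only [Finset.coe_empty, Set.union_empty] at key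
  rw [greedyLaw_append, mean_bind, unspanned, ← key, ← mean_const_mul]
  refine mean_mono_support fun X hX => ?_
  have hXi := (support_greedyLaw M q T hX h0).2.2
  by_cases hc : e ∈ M.closure X
  · simp [hc]
  · have hi := (hXi.notMem_closure_iff (by rw [hM]; trivial)).1 hc
    have hi' : M.Indep (insert e X : Finset (Fin n)) := by push_cast; exact hi.1
    rw [if_neg hc, greedyLaw, mean_bind, mean_greedyStep, if_pos ⟨he, hi'⟩]
    refine le_add_right ?_
    gcongr
    exact hmem _ hi' (Finset.mem_insert_self _ _)

theorem unspanned_insert_le {e : Fin n} (hM : M.E = Set.univ) (he : e ∉ T) :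
    unspanned M q (insert e T) e ≤ unspanned M q T e := by
  classical
  have h0 : (subsetMean q T fun B =>
      if e ∈ M.closure (insert e B : Finset (Fin n)) then (0 : ℝ≥0∞) else 1) = 0 := by
    refine Eq.trans ?_ (subsetMean_const q T 0)
    refine subsetMean_congr q T fun B _ => if_pos ?_
    exact M.mem_closure_of_mem' (by simp) (by rw [hM]; trivial)
  rw [unspanned, subsetMean_insert q he, h0, mul_zero, zero_add]
  refine mul_le_of_le_one_left' ?_
  rw [← ENNReal.ofReal_one]
  exact ENNReal.ofReal_le_ofReal (by linarith [q.2.1])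

/-- A subsample of `T` has expected size `q |T|`, and leaves at least `|I| - |B|` elements of an
independent set `I` unspanned. -/
theorem card_indep_le {I : Finset (Fin n)} (hI : M.Indep (I : Set (Fin n))) (hIT : I ⊆ T) :
    (I.card : ℝ≥0∞) ≤ ENNReal.ofReal q * T.card + ∑ i ∈ T, unspanned M q T i := by
  classical
  have h : ∀ B : Finset (Fin n),
      (I.card : ℝ≥0∞) ≤ B.card + ∑ i ∈ T, if i ∈ M.closure B then (0 : ℝ≥0∞) else 1 := by
    intro B
    have h1 : (I.filter fun i => i ∈ M.closure B).card ≤ B.card := by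
      have hJ : M.Indep ((I.filter fun i => i ∈ M.closure B : Finset (Fin n)) : Set (Fin n)) :=
        hI.subset (by exact_mod_cast Finset.filter_subset _ _)
      have h2 := hJ.encard_le_eRk_of_subset (X := M.closure B) (fun i hi => by simp at hi; exact hi.2)
      rw [Matroid.eRk_closure_eq] at h2
      have h3 := h2.trans (M.eRk_le_encard B)
      rw [Set.encard_coe_eq_coe_finsetCard, Set.encard_coe_eq_coe_finsetCard] at h3
      exact_mod_cast h3
    have h2 : ((I.filter fun i => i ∉ M.closure B).card : ℝ≥0∞) ≤
        ∑ i ∈ T, if i ∈ M.closure B then (0 : ℝ≥0∞) else 1 := by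
      refine le_trans (le_of_eq ?_) (Finset.sum_le_sum_of_subset hIT)
      rw [Finset.card_filter]
      push_cast
      exact Finset.sum_congr rfl fun i _ => by split_ifs <;> rfl
    rw [← Finset.card_filter_add_card_filter_not (s := I) fun i => i ∈ M.closure B]
    push_cast
    exact add_le_add (by exact_mod_cast h1) h2
  have := subsetMean_mono q T fun B _ => h B
  rw [subsetMean_const, subsetMean_add, subsetMean_card, subsetMean_sum] at this
  exact this

end Greedy

/-! ### The existence of a rarely spanned element -/

section Averaging

variable {n : ℕ} (J : Instance n) (q : unitInterval) (S : Finset (Fin n))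

/-- The probability that an element is active, as an extended real. -/
def activeProb (i : Fin n) : ℝ≥0∞ := J.D.toOuterMeasure {A | i ∈ A}

open Classical in
/-- The probability that an element is active and not spanned by a subsample of the active elements
of `S`. -/
def freeProb (i : Fin n) : ℝ≥0∞ :=
  mean J.D fun A => if i ∈ A then unspanned J.M q (A ∩ S) i else 0

theorem activeProb_eq_mean (i : Fin n) :
    activeProb J i = mean J.D fun A => if i ∈ A then 1 else 0 := (mean_ite _ _).symm

theorem ofReal_prob_active (i : Fin n) :
    ENNReal.ofReal (prob J.D {A | i ∈ A}) = activeProb J i := ofReal_prob _ _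

theorem activeProb_le_one (i : Fin n) : activeProb J i ≤ 1 := toOuterMeasure_le_one _ _

theorem freeProb_le_activeProb (i : Fin n) : freeProb J q S i ≤ activeProb J i := by
  classical
  rw [activeProb_eq_mean]
  exact mean_mono fun A => by
    split_ifs
    · exact unspanned_le_one _ _ _ _
    · exact le_rfl

theorem mean_crsLaw {M : Matroid (Fin n)} (D : PMF (Finset (Fin n))) (Dφ : PMF (SelectionMap M))
    (f : Finset (Fin n) × Finset (Fin n) → ℝ≥0∞) :
    mean (crsLaw D Dφ) f = mean D fun A => mean Dφ fun φ => f (A, φ.1 A) := by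
  simp only [crsLaw, mean_bind, mean_map]

/-- In a balanced scheme every element is selected with probability at least `α` times its
probability of being active. -/
theorem le_mean_selected {α : ℝ} (hα : 0 ≤ α) {Dφ : PMF (SelectionMap J.M)}
    (h : IsBalanced (crsLaw J.D Dφ) α) (i : Fin n) :
    ENNReal.ofReal α * activeProb J i ≤
      mean J.D fun A => mean Dφ fun φ => if i ∈ φ.1 A then 1 else 0 := by
  have hA : prob (crsLaw J.D Dφ) {ω | i ∈ ω.1} = prob J.D {A | i ∈ A} := by
    rw [← toReal_mean_ite, ← toReal_mean_ite, mean_crsLaw]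
    exact congrArg _ (congrArg _ (funext fun A => mean_const Dφ (if i ∈ A then 1 else 0)))
  have hpos := J.pos i
  have h1 := h i (hA ▸ hpos)
  rw [condProb, hA, le_div_iff₀ hpos] at h1
  rw [← ofReal_prob_active, ← ENNReal.ofReal_mul hα]
  refine (ENNReal.ofReal_le_ofReal h1).trans ?_
  rw [ofReal_prob]
  refine (J.D.bind _).toOuterMeasure_mono (t := {ω | i ∈ ω.2}) (fun ω hω => hω.1.1) |>.trans ?_
  have := mean_ite (crsLaw J.D Dφ) fun ω => i ∈ ω.2
  rw [mean_crsLaw] at this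
  exact this.symm.le

theorem sum_active_le {α : ℝ} (hα : 0 ≤ α) (h : J.Uncontentious α) :
    ENNReal.ofReal α * ∑ i ∈ S, activeProb J i ≤
      ENNReal.ofReal q * ∑ i ∈ S, activeProb J i + ∑ i ∈ S, freeProb J q S i := by
  classical
  obtain ⟨Dφ, hb⟩ := h
  have hcard : ∀ T : Finset (Fin n), ((T ∩ S).card : ℝ≥0∞) = ∑ i ∈ S, if i ∈ T then 1 else 0 := by
    intro T
    rw [Finset.sum_boole, Finset.inter_comm, Finset.filter_mem_eq_inter]
  have hfree : ∀ A : Finset (Fin n), ∑ i ∈ A ∩ S, unspanned J.M q (A ∩ S) i =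
      ∑ i ∈ S, if i ∈ A then unspanned J.M q (A ∩ S) i else 0 := by
    intro A
    rw [← Finset.sum_filter, Finset.filter_mem_eq_inter, Finset.inter_comm]
  have key : (mean J.D fun A => mean Dφ fun φ => ∑ i ∈ S, if i ∈ φ.1 A then (1 : ℝ≥0∞) else 0) ≤
      mean J.D fun A => ENNReal.ofReal q * ∑ i ∈ S, (if i ∈ A then 1 else 0) +
        ∑ i ∈ S, if i ∈ A then unspanned J.M q (A ∩ S) i else 0 := by
    refine mean_mono fun A => ?_
    refine le_trans (mean_mono fun φ => ?_) (mean_const Dφ _).le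
    rw [← hcard, ← hcard, ← hfree]
    exact card_indep_le J.M q (A ∩ S)
      ((φ.2 A).2.subset (by exact_mod_cast Finset.inter_subset_left))
      (Finset.inter_subset_inter_right (φ.2 A).1)
  simp only [mean_add, mean_const_mul, mean_sum, ← activeProb_eq_mean] at key
  refine le_trans ?_ key
  rw [Finset.mul_sum]
  exact Finset.sum_le_sum fun i _ => le_mean_selected J hα hb i

/-- If the prior is `α`-uncontentious, then some element of `S` is rarely spanned by a subsample
of `S`. -/
theorem exists_le_freeProb {α : ℝ} (hq : (q : ℝ) ≤ α) (h : J.Uncontentious α) (hS : S.Nonempty) :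
    ∃ i ∈ S, ENNReal.ofReal (α - q) * activeProb J i ≤ freeProb J q S i := by
  by_contra! hlt
  have h1 := sum_active_le J q S (q.2.1.trans hq) h
  have h2 := ENNReal.sum_lt_sum_of_nonempty hS hlt
  have hfin : ENNReal.ofReal q * ∑ i ∈ S, activeProb J i ≠ ∞ :=
    ENNReal.mul_ne_top ENNReal.ofReal_ne_top
      (ENNReal.sum_ne_top.2 fun i _ => ne_top_of_le_ne_top ENNReal.one_ne_top (activeProb_le_one J i))
  have h3 := ENNReal.add_lt_add_left hfin h2
  rw [← Finset.mul_sum, ← add_mul, ← ENNReal.ofReal_add q.2.1 (sub_nonneg.2 hq)] at h3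
  rw [add_sub_cancel] at h3
  exact absurd (h1.trans_lt h3) (lt_irrefl _)

end Averaging

/-! ### The empirical scores -/

section Scores

variable {n : ℕ} (J : Instance n) (q : unitInterval) (c₁ c₂ : ℕ) (S : Finset (Fin n))

/-- For every element its gains and its losses so far. -/
abbrev Scores (n : ℕ) : Type := Fin n → ℕ × ℕ

open Classical in
/-- The elements of `T` that are not spanned by `X` gain `c₁`, and the other elements of `T` lose
`c₂`. -/
def updateScores (T X : Finset (Fin n)) (sc : Scores n) : Scores n := fun j =>
  if j ∈ T then
    if j ∈ J.M.closure X then ((sc j).1, (sc j).2 + c₂) else ((sc j).1 + c₁, (sc j).2)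
  else sc j

open Classical in
/-- The effect of one sample of the prior on the scores, when the elements of `S` are left. -/
def sampleLaw (sc : Scores n) : PMF (Scores n) :=
  J.D.bind fun A => (greedyLaw J.M q (A ∩ S) (List.finRange n) ∅).map fun X =>
    updateScores J c₁ c₂ (A ∩ S) X sc

/-- The scores after several independent samples. -/
def scoreLaw : ℕ → PMF (Scores n)
  | 0 => PMF.pure 0
  | m + 1 => (scoreLaw m).bind (sampleLaw J q c₁ c₂ S)

/-- The exponential moment of the score of one element. -/
def potential (t : ℝ) (j : Fin n) (sc : Scores n) : ℝ≥0∞ :=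
  ENNReal.ofReal (Real.exp (t * ((sc j).1 - (sc j).2)))

theorem one_le_potential {t : ℝ} {j : Fin n} {sc : Scores n}
    (h : 0 ≤ t * (((sc j).1 : ℝ) - (sc j).2)) : 1 ≤ potential t j sc := by
  rw [potential, ← ENNReal.ofReal_one]
  exact ENNReal.ofReal_le_ofReal (Real.one_le_exp h)

theorem potential_add_fst (t : ℝ) (x u v : ℕ) :
    ENNReal.ofReal (Real.exp (t * (((u + x : ℕ) : ℝ) - v))) =
      ENNReal.ofReal (Real.exp (t * ((u : ℝ) - v))) * ENNReal.ofReal (Real.exp (t * x)) := by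
  rw [← ENNReal.ofReal_mul (Real.exp_nonneg _), ← Real.exp_add]
  push_cast
  ring_nf

theorem potential_add_snd (t : ℝ) (x u v : ℕ) :
    ENNReal.ofReal (Real.exp (t * ((u : ℝ) - (v + x : ℕ)))) =
      ENNReal.ofReal (Real.exp (t * ((u : ℝ) - v))) * ENNReal.ofReal (Real.exp (-(t * x))) := by
  rw [← ENNReal.ofReal_mul (Real.exp_nonneg _), ← Real.exp_add]
  push_cast
  ring_nf

variable {S}

theorem mean_sampleLaw_potential (t : ℝ) {j : Fin n} (hj : j ∈ S) (sc : Scores n) :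
    mean (sampleLaw J q c₁ c₂ S sc) (potential t j) = potential t j sc *
      (ENNReal.ofReal (Real.exp (t * c₁)) * freeProb J q S j +
        ENNReal.ofReal (Real.exp (-(t * c₂))) * (activeProb J j - freeProb J q S j) +
        (1 - activeProb J j)) := by
  classical
  set x := ENNReal.ofReal (Real.exp (t * c₁))
  set y := ENNReal.ofReal (Real.exp (-(t * c₂)))
  have hinner : ∀ A : Finset (Fin n),
      (mean (greedyLaw J.M q (A ∩ S) (List.finRange n) ∅) fun X =>
        potential t j (updateScores J c₁ c₂ (A ∩ S) X sc)) =
      potential t j sc * (x * (if j ∈ A then unspanned J.M q (A ∩ S) j else 0) +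
        y * (if j ∈ A then 1 - unspanned J.M q (A ∩ S) j else 0) + if j ∈ A then 0 else 1) := by
    intro A
    by_cases hA : j ∈ A
    · have h1 := mean_greedyLaw_closure J.M q (A ∩ S) J.ground
        (fun F => potential t j sc * (if j ∈ F then y else x)) (List.nodup_finRange n)
        (X := ∅) (by simp)
      have h2 : ∀ X : Finset (Fin n), potential t j (updateScores J c₁ c₂ (A ∩ S) X sc) =
          potential t j sc * (if j ∈ J.M.closure X then y else x) := by
        intro X
        unfold potential updateScores
        rw [if_pos (Finset.mem_inter.2 ⟨hA, hj⟩)]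
        split_ifs
        · exact potential_add_snd _ _ _ _
        · exact potential_add_fst _ _ _ _
      simp only [h2, h1, if_pos hA, add_zero]
      simp only [List.toFinset_finRange, Finset.univ_inter, Finset.coe_empty, Set.union_empty]
      have hs : (subsetMean q (A ∩ S) fun B => if j ∈ J.M.closure B then (1 : ℝ≥0∞) else 0) =
          1 - unspanned J.M q (A ∩ S) j := by
        refine ENNReal.eq_sub_of_add_eq
          (ne_top_of_le_ne_top ENNReal.one_ne_top (unspanned_le_one _ _ _ _)) ?_
        rw [unspanned, ← subsetMean_add]
        refine Eq.trans ?_ (subsetMean_const q (A ∩ S) 1)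
        exact subsetMean_congr _ _ fun B _ => by split_ifs <;> simp
      rw [← hs, unspanned]
      simp only [subsetMean, Finset.mul_sum, ← Finset.sum_add_distrib]
      refine Finset.sum_congr rfl fun B _ => ?_
      split_ifs <;> ring
    · have h2 : ∀ X : Finset (Fin n), potential t j (updateScores J c₁ c₂ (A ∩ S) X sc) =
          potential t j sc := by
        intro X
        unfold potential updateScores
        rw [if_neg fun h => hA (Finset.mem_inter.1 h).1]
      simp only [h2, mean_const, if_neg hA, mul_zero, zero_add, mul_one]
  rw [sampleLaw, mean_bind]
  simp only [mean_map, hinner, mean_const_mul, mean_add]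
  have ha : activeProb J j ≠ ∞ := ne_top_of_le_ne_top ENNReal.one_ne_top (activeProb_le_one J j)
  congr 2
  · congr 2
    refine ENNReal.eq_sub_of_add_eq (ne_top_of_le_ne_top ha (freeProb_le_activeProb J q S j)) ?_
    rw [freeProb, ← mean_add, activeProb_eq_mean]
    congr 1
    funext A
    split_ifs
    · exact tsub_add_cancel_of_le (unspanned_le_one _ _ _ _)
    · simp
  · refine ENNReal.eq_sub_of_add_eq ha ?_
    rw [activeProb_eq_mean, ← mean_add]
    refine Eq.trans ?_ (mean_const J.D 1)
    congr 1
    funext A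
    split_ifs <;> simp

/-- One step of a Chernoff bound for a variable that is `c₁` with probability `a`, `-c₂` with
probability `p - a`, and zero otherwise. -/
theorem exp_moment_le {t a p c₁ c₂ : ℝ} (ha : 0 ≤ a) (hap : a ≤ p) (hc₁ : 0 ≤ c₁) (hc₂ : 0 ≤ c₂)
    (ht : |t| * (c₁ + c₂) ≤ 1) :
    Real.exp (t * c₁) * a + Real.exp (-(t * c₂)) * (p - a) + (1 - p) ≤
      1 + t * (c₁ * a - c₂ * (p - a)) + (t * (c₁ + c₂)) ^ 2 * p := by
  have habs := abs_nonneg t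
  have h1 : |t * c₁| ≤ 1 := by
    rw [abs_mul, abs_of_nonneg hc₁]
    nlinarith
  have h2 : |-(t * c₂)| ≤ 1 := by
    rw [abs_neg, abs_mul, abs_of_nonneg hc₂]
    nlinarith
  have e1 := (abs_le.1 (Real.abs_exp_sub_one_sub_id_le h1)).2
  have e2 := (abs_le.1 (Real.abs_exp_sub_one_sub_id_le h2)).2
  have s1 : (t * c₁) ^ 2 ≤ (t * (c₁ + c₂)) ^ 2 := by
    rw [mul_pow, mul_pow]
    gcongr
    linarith
  have s2 : (-(t * c₂)) ^ 2 ≤ (t * (c₁ + c₂)) ^ 2 := by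
    rw [neg_sq, mul_pow, mul_pow]
    gcongr
    linarith
  nlinarith [mul_le_mul_of_nonneg_right (e1.trans s1) ha,
    mul_le_mul_of_nonneg_right (e2.trans s2) (sub_nonneg.2 hap)]

/-- If the drift of the score has the sign opposite to `t`, then the exponential moment decreases
geometrically. -/
theorem mean_scoreLaw_potential_le {t η : ℝ} (hη : η ≤ 2)
    (ht : |t| * (2 * (c₁ + c₂ : ℕ)) = η) {j : Fin n} (hj : j ∈ S) {π : ℝ}
    (hπ : π ≤ (activeProb J j).toReal)
    (hdrift : t * ((c₁ + c₂ : ℕ) * (freeProb J q S j).toReal - c₂ * (activeProb J j).toReal) ≤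
      -(η ^ 2 / 2 * (activeProb J j).toReal)) (m : ℕ) :
    mean (scoreLaw J q c₁ c₂ S m) (potential t j) ≤
      ENNReal.ofReal (Real.exp (-(m * (π * η ^ 2 / 4)))) := by
  have hstep : ENNReal.ofReal (Real.exp (t * c₁)) * freeProb J q S j +
        ENNReal.ofReal (Real.exp (-(t * c₂))) * (activeProb J j - freeProb J q S j) +
        (1 - activeProb J j) ≤ ENNReal.ofReal (Real.exp (-(π * η ^ 2 / 4))) := by
    have hp := activeProb_le_one J j
    have hf := freeProb_le_activeProb J q S j
    have hp' : activeProb J j ≠ ∞ := ne_top_of_le_ne_top ENNReal.one_ne_top hp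
    have hf' := ne_top_of_le_ne_top hp' hf
    have e1 := (ENNReal.ofReal_toReal hf').symm
    have e2 := (ENNReal.ofReal_toReal hp').symm
    have hap := ENNReal.toReal_mono hp' hf
    have hp1 := ENNReal.toReal_mono ENNReal.one_ne_top hp
    set a := (freeProb J q S j).toReal
    set p := (activeProb J j).toReal
    have ha : 0 ≤ a := ENNReal.toReal_nonneg
    have hp0 : 0 ≤ p := ENNReal.toReal_nonneg
    rw [ENNReal.toReal_one] at hp1
    rw [e1, e2, ← ENNReal.ofReal_sub _ ha, ← ENNReal.ofReal_one, ← ENNReal.ofReal_sub _ hp0,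
      ← ENNReal.ofReal_mul (Real.exp_nonneg _), ← ENNReal.ofReal_mul (Real.exp_nonneg _),
      ← ENNReal.ofReal_add (by positivity)
        (mul_nonneg (Real.exp_nonneg _) (sub_nonneg.2 hap)),
      ← ENNReal.ofReal_add (add_nonneg (by positivity)
        (mul_nonneg (Real.exp_nonneg _) (sub_nonneg.2 hap))) (sub_nonneg.2 hp1)]
    refine ENNReal.ofReal_le_ofReal ?_
    push_cast at ht hdrift
    have hsq : (t * (c₁ + c₂ : ℝ)) ^ 2 = η ^ 2 / 4 := by
      rw [← ht, mul_pow, ← sq_abs t]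
      ring
    have hb := exp_moment_le (t := t) ha hap (Nat.cast_nonneg c₁) (Nat.cast_nonneg c₂)
      (by linarith)
    rw [hsq] at hb
    have h3 : π * η ^ 2 / 4 ≤ p * η ^ 2 / 4 := by gcongr
    have h4 := Real.add_one_le_exp (-(π * η ^ 2 / 4))
    nlinarith
  induction m with
  | zero => simp [scoreLaw, mean_pure, potential]
  | succ m ih =>
    rw [scoreLaw, mean_bind]
    simp only [mean_sampleLaw_potential J q c₁ c₂ t hj]
    calc _ ≤ mean (scoreLaw J q c₁ c₂ S m) fun sc => ENNReal.ofReal (Real.exp (-(π * η ^ 2 / 4))) *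
          potential t j sc := mean_mono fun sc => by rw [mul_comm]; gcongr
      _ ≤ ENNReal.ofReal (Real.exp (-(π * η ^ 2 / 4))) *
          ENNReal.ofReal (Real.exp (-(m * (π * η ^ 2 / 4)))) := by
        rw [mean_const_mul]
        gcongr
      _ = _ := by
        rw [← ENNReal.ofReal_mul (Real.exp_nonneg _), ← Real.exp_add]
        push_cast
        ring_nf

end Scores

/-! ### The choice of the order -/

section Order

variable {n : ℕ}

open Classical in
/-- The last `j < k` that satisfies `Q`, or `d` if there is none. -/
def lastOr (Q : Fin n → Prop) (d : ℕ) : ℕ → ℕ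
  | 0 => d
  | k + 1 => if ∃ h : k < n, Q ⟨k, h⟩ then k else lastOr Q d k

theorem lastOr_cases (Q : Fin n → Prop) (d k : ℕ) :
    (lastOr Q d k = d ∧ ∀ j : Fin n, (j : ℕ) < k → ¬ Q j) ∨
      ∃ j : Fin n, Q j ∧ lastOr Q d k = j := by
  induction k with
  | zero => exact Or.inl ⟨rfl, fun j hj => absurd hj (Nat.not_lt_zero _)⟩
  | succ k ih =>
    by_cases h : ∃ h : k < n, Q ⟨k, h⟩
    · obtain ⟨hk, hQ⟩ := h
      exact Or.inr ⟨⟨k, hk⟩, hQ, by rw [lastOr, if_pos ⟨hk, hQ⟩]⟩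
    · rw [lastOr, if_neg h]
      refine ih.imp_left fun ⟨h1, h2⟩ => ⟨h1, fun j hj hQ => ?_⟩
      rcases Nat.lt_succ_iff_lt_or_eq.1 hj with hj | rfl
      · exact h2 j hj hQ
      · exact h ⟨j.2, hQ⟩

/-- The element that is chosen from `S`: the last one whose gains are at least its losses, if there
is one, and otherwise the last element of `S`. -/
def pick (S : Finset (Fin n)) (sc : Scores n) : ℕ :=
  lastOr (fun j => j ∈ S ∧ (sc j).2 ≤ (sc j).1) (lastOr (fun j => j ∈ S) 0 n) n

theorem exists_pick_eq {S : Finset (Fin n)} (hS : S.Nonempty) (sc : Scores n) :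
    ∃ e ∈ S, pick S sc = e ∧ ((∃ i ∈ S, (sc i).2 ≤ (sc i).1) → (sc e).2 ≤ (sc e).1) := by
  rcases lastOr_cases (fun j => j ∈ S ∧ (sc j).2 ≤ (sc j).1) (lastOr (fun j => j ∈ S) 0 n) n with
    ⟨h1, h2⟩ | ⟨e, he, h⟩
  · rcases lastOr_cases (fun j => j ∈ S) 0 n with ⟨-, h3⟩ | ⟨e, he, h⟩
    · obtain ⟨i, hi⟩ := hS
      exact absurd hi (h3 i i.2)
    · exact ⟨e, he, h1.trans h, fun ⟨i, hi⟩ => absurd hi (h2 i i.2)⟩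
  · exact ⟨e, he.1, h, fun _ => he.2⟩

/-- Put the element with number `v` in front of a list. -/
def extend (l : List (Fin n)) (v : ℕ) : List (Fin n) := if h : v < n then ⟨v, h⟩ :: l else l

theorem extend_val (l : List (Fin n)) (e : Fin n) : extend l e = e :: l := by simp [extend]

/-- The elements that are not in a list. -/
def remaining (l : List (Fin n)) : Finset (Fin n) := Finset.univ.filter fun i => i ∉ l

theorem mem_remaining {l : List (Fin n)} {i : Fin n} : i ∈ remaining l ↔ i ∉ l := by
  simp [remaining]

theorem remaining_nonempty {l : List (Fin n)} (h : l.length < n) : (remaining l).Nonempty := by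
  by_contra hne
  rw [Finset.not_nonempty_iff_eq_empty, remaining, Finset.filter_eq_empty_iff] at hne
  have h1 : (Finset.univ : Finset (Fin n)) ⊆ l.toFinset := fun i hi => by
    simpa using hne hi
  have h2 := (Finset.card_le_card h1).trans l.toFinset_card_le
  rw [Finset.card_univ, Fintype.card_fin] at h2
  omega

variable (J : Instance n) (q : unitInterval) (c₁ c₂ m : ℕ)

/-- The law of the final segment of length `k` of the arrival order. -/
def orderLaw : ℕ → PMF (List (Fin n))
  | 0 => PMF.pure []
  | k + 1 => (orderLaw k).bind fun l =>
    (scoreLaw J q c₁ c₂ (remaining l) m).map fun sc => extend l (pick (remaining l) sc)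

theorem support_orderLaw {k : ℕ} (hk : k ≤ n) {l : List (Fin n)}
    (h : l ∈ (orderLaw J q c₁ c₂ m k).support) : l.Nodup ∧ l.length = k := by
  induction k generalizing l with
  | zero =>
    rw [orderLaw, PMF.support_pure, Set.mem_singleton_iff] at h
    simp [h]
  | succ k ih =>
    rw [orderLaw] at h
    obtain ⟨l', hl', h⟩ := (PMF.mem_support_bind_iff _ _ _).1 h
    obtain ⟨sc, -, rfl⟩ := (PMF.mem_support_map_iff _ _ _).1 h
    obtain ⟨h1, h2⟩ := ih (Nat.le_of_succ_le hk) hl'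
    obtain ⟨e, he, hp, -⟩ := exists_pick_eq (remaining_nonempty (l := l') (by omega)) sc
    rw [hp, extend_val]
    exact ⟨List.nodup_cons.2 ⟨mem_remaining.1 he, h1⟩, by simp [h2]⟩

/-- Every element of the list is rarely spanned by a subsample of the elements that do not come
after it. -/
def GoodOrder (θ : ℝ≥0∞) : List (Fin n) → Prop
  | [] => True
  | e :: l => θ * activeProb J e ≤ freeProb J q (remaining l) e ∧ GoodOrder θ l

theorem GoodOrder.of_append {θ : ℝ≥0∞} {l₁ l₂ : List (Fin n)}
    (h : GoodOrder J q θ (l₁ ++ l₂)) : GoodOrder J q θ l₂ := by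
  induction l₁ with
  | nil => exact h
  | cons e l ih => exact ih h.2

theorem pMin_le (i : Fin n) : J.pMin ≤ (activeProb J i).toReal :=
  ciInf_le (Set.finite_range _).bddBelow i

open Classical in
/-- With high probability the chosen element is rarely spanned: an element that is spanned too often
has negative score, and the element that exists by averaging has positive score, except with a
probability that is bounded by an exponential moment. -/
theorem mean_pick_bad_le {α τ η : ℝ} (hb : 0 < c₁ + c₂) (hη0 : 0 < η) (hη : η ≤ 2)
    (hτ : (c₂ : ℝ) = τ * (c₁ + c₂)) (hτη : η ≤ τ) (hq : (q : ℝ) ≤ α) (hτα : τ + η ≤ α - q)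
    (hJ : J.Uncontentious α) {S : Finset (Fin n)} (hS : S.Nonempty) :
    (mean (scoreLaw J q c₁ c₂ S m) fun sc =>
      if ∃ e ∈ S, pick S sc = e ∧
        ENNReal.ofReal (τ - η) * activeProb J e ≤ freeProb J q S e then 0 else 1) ≤
      n * ENNReal.ofReal (Real.exp (-(m * (J.pMin * η ^ 2 / 4)))) := by
  set p := fun i : Fin n => (activeProb J i).toReal with hp_def
  set a := fun i : Fin n => (freeProb J q S i).toReal with ha_def
  set β := ENNReal.ofReal (Real.exp (-(m * (J.pMin * η ^ 2 / 4))))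
  have htop1 : ∀ i, activeProb J i ≠ ∞ := fun i =>
    ne_top_of_le_ne_top ENNReal.one_ne_top (activeProb_le_one J i)
  have htop2 : ∀ i, freeProb J q S i ≠ ∞ := fun i =>
    ne_top_of_le_ne_top (htop1 i) (freeProb_le_activeProb J q S i)
  have hreal : ∀ {θ : ℝ}, 0 ≤ θ → ∀ i,
      (ENNReal.ofReal θ * activeProb J i ≤ freeProb J q S i ↔ θ * p i ≤ a i) := by
    intro θ hθ i
    rw [← ENNReal.toReal_le_toReal (ENNReal.mul_ne_top ENNReal.ofReal_ne_top (htop1 i)) (htop2 i),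
      ENNReal.toReal_mul, ENNReal.toReal_ofReal hθ]
  obtain ⟨i₀, hi₀S, hi₀⟩ := exists_le_freeProb J q S hq hJ hS
  rw [hreal (sub_nonneg.2 hq)] at hi₀
  have hb' : (0 : ℝ) < c₁ + c₂ := by exact_mod_cast hb
  set t := η / (2 * (c₁ + c₂ : ℝ)) with ht_def
  have ht : 0 < t := by positivity
  have htb : t * (2 * (c₁ + c₂ : ℝ)) = η := by rw [ht_def]; field_simp
  have hc₂ : ∀ j, t * ((c₁ + c₂ : ℕ) * a j - c₂ * p j) = η / 2 * (a j - τ * p j) := by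
    intro j
    rw [← htb]
    push_cast
    linear_combination (-(t * p j)) * hτ
  have hp0 : ∀ j, 0 ≤ p j := fun j => ENNReal.toReal_nonneg
  -- the events whose union contains the failure, each measured by its exponential moment
  set w : Fin n → Scores n → ℝ≥0∞ := fun j sc =>
    if (τ + η) * p j ≤ a j then potential (-t) j sc
    else if a j ≤ (τ - η) * p j then potential t j sc else 0 with hw
  have hmean : ∀ j ∈ S, mean (scoreLaw J q c₁ c₂ S m) (w j) ≤ β := by
    intro j hj
    simp only [hw]
    split_ifs with h1 h2
    · refine mean_scoreLaw_potential_le J q c₁ c₂ (η := η) hη ?_ hj (pMin_le J j) ?_ m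
      · rw [abs_neg, abs_of_pos ht]
        push_cast
        exact htb
      · rw [neg_mul, hc₂]
        simp only [hp_def, ha_def] at h1 ⊢
        nlinarith
    · refine mean_scoreLaw_potential_le J q c₁ c₂ (η := η) hη ?_ hj (pMin_le J j) ?_ m
      · rw [abs_of_pos ht]
        push_cast
        exact htb
      · rw [hc₂]
        simp only [hp_def, ha_def] at h2 ⊢
        nlinarith
    · simp [mean]
  calc _ ≤ mean (scoreLaw J q c₁ c₂ S m) fun sc => ∑ j ∈ S, w j sc := by
        refine mean_mono fun sc => ?_
        split_ifs with hgood
        · exact zero_le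
        obtain ⟨e, he, hpe, hbest⟩ := exists_pick_eq hS sc
        by_cases hex : ∃ i ∈ S, (sc i).2 ≤ (sc i).1
        · have hsc := hbest hex
          have hbad : ¬ (τ - η) * p e ≤ a e := fun h =>
            hgood ⟨e, he, hpe, (hreal (sub_nonneg.2 hτη) e).2 h⟩
          refine le_trans ?_ (Finset.single_le_sum (fun _ _ => zero_le) he)
          have h1 : ¬ (τ + η) * p e ≤ a e := fun h => hbad (by nlinarith [hp0 e])
          simp only [hw]
          rw [if_neg h1, if_pos (not_le.1 hbad).le]
          refine one_le_potential (mul_nonneg ht.le (sub_nonneg.2 ?_))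
          exact_mod_cast hsc
        · push Not at hex
          refine le_trans ?_ (Finset.single_le_sum (fun _ _ => zero_le) hi₀S)
          simp only [hw]
          rw [if_pos (by nlinarith [hp0 i₀])]
          refine one_le_potential ?_
          have : ((sc i₀).1 : ℝ) ≤ (sc i₀).2 := by exact_mod_cast (hex i₀ hi₀S).le
          nlinarith
    _ = ∑ j ∈ S, mean (scoreLaw J q c₁ c₂ S m) (w j) := mean_sum _ _ _
    _ ≤ ∑ j ∈ S, β := Finset.sum_le_sum hmean
    _ ≤ n * β := by
        rw [Finset.sum_const, nsmul_eq_mul]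
        gcongr
        exact (Finset.card_le_univ S).trans_eq (Fintype.card_fin n)

open Classical in
theorem mean_not_goodOrder_le {θ δ : ℝ≥0∞}
    (h : ∀ S : Finset (Fin n), S.Nonempty → (mean (scoreLaw J q c₁ c₂ S m) fun sc =>
      if ∃ e ∈ S, pick S sc = e ∧ θ * activeProb J e ≤ freeProb J q S e then 0 else 1) ≤ δ)
    {k : ℕ} (hk : k ≤ n) :
    (mean (orderLaw J q c₁ c₂ m k) fun l => if GoodOrder J q θ l then 0 else 1) ≤ k * δ := by
  induction k with
  | zero => simp [orderLaw, mean_pure, GoodOrder]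
  | succ k ih =>
    rw [orderLaw, mean_bind]
    calc _ ≤ mean (orderLaw J q c₁ c₂ m k) fun l =>
          (if GoodOrder J q θ l then 0 else 1) + δ := by
          refine mean_mono_support fun l hl => ?_
          obtain ⟨-, hlen⟩ := support_orderLaw J q c₁ c₂ m (Nat.le_of_succ_le hk) hl
          have hne := remaining_nonempty (l := l) (by omega)
          rw [mean_map]
          refine le_trans (mean_mono fun sc => ?_) ((mean_add _ _ _).trans_le
            (add_le_add (mean_const _ _).le (h _ hne)))
          by_cases hl : GoodOrder J q θ l
          · by_cases he : ∃ e ∈ remaining l, pick (remaining l) sc = e ∧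
              θ * activeProb J e ≤ freeProb J q (remaining l) e
            · obtain ⟨e, -, hpe, hfe⟩ := he
              rw [hpe, extend_val, if_pos ⟨hfe, hl⟩]
              exact zero_le
            · rw [if_neg he]
              refine le_add_left ?_
              split_ifs <;> simp
          · rw [if_neg hl]
            refine le_add_right ?_
            split_ifs <;> simp
      _ ≤ _ := by
          rw [mean_add, mean_const]
          push_cast
          rw [add_mul, one_mul]
          gcongr
          exact ih (Nat.le_of_succ_le hk)

/-- The law of the active and the selected set when the order is selected by the scores. -/
def jointLaw : PMF (Finset (Fin n) × Finset (Fin n)) :=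
  (orderLaw J q c₁ c₂ m n).bind fun l =>
    J.D.bind fun A => (greedyLaw J.M q A l ∅).map fun X => (A, X)

theorem le_mean_selected_of_goodOrder {θ : ℝ≥0∞} {l : List (Fin n)} (hl : l.Nodup)
    (hlen : l.length = n) (hgood : GoodOrder J q θ l) (i : Fin n) :
    ENNReal.ofReal q * (θ * activeProb J i) ≤ mean J.D fun A =>
      mean (greedyLaw J.M q A l ∅) fun X => if i ∈ X ∧ i ∈ A then 1 else 0 := by
  have hil : i ∈ l := by
    have h1 : l.toFinset = Finset.univ := by
      rw [← Finset.card_eq_iff_eq_univ, List.toFinset_card_of_nodup hl, hlen, Fintype.card_fin]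
    rw [← List.mem_toFinset, h1]
    exact Finset.mem_univ i
  obtain ⟨l₁, l₂, rfl⟩ := List.append_of_mem hil
  have hall : ∀ j, j ∈ l₁ ++ i :: l₂ := by
    intro j
    have h1 : (l₁ ++ i :: l₂).toFinset = Finset.univ := by
      rw [← Finset.card_eq_iff_eq_univ, List.toFinset_card_of_nodup hl, hlen, Fintype.card_fin]
    rw [← List.mem_toFinset, h1]
    exact Finset.mem_univ j
  have h1 := hgood.of_append.1
  refine le_trans (mul_le_mul_right h1 _) ?_
  rw [freeProb, ← mean_const_mul]
  refine mean_mono fun A => ?_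
  by_cases hiA : i ∈ A
  · have hnd := List.nodup_append.1 hl
    have hi₁ : i ∉ l₁ := fun h => hnd.2.2 i h i (by simp) rfl
    have hset : A ∩ remaining l₂ = insert i (l₁.toFinset ∩ A) := by
      ext j
      have hj := hall j
      have h2 : j ∈ l₁ → j ∉ l₂ := fun h h' => hnd.2.2 j h j (by simp [h']) rfl
      have h3 := (List.nodup_cons.1 hnd.2.1).1
      simp only [Finset.mem_inter, mem_remaining, Finset.mem_insert, List.mem_toFinset,
        List.mem_append, List.mem_cons] at hj ⊢
      constructor
      · tauto
      · rintro (rfl | h)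
        · exact ⟨hiA, h3⟩
        · exact ⟨h.2, h2 h.1⟩
    simp only [hiA, and_true, if_true]
    refine le_trans ?_ (le_mean_greedyLaw_mem J.M q A J.ground hnd.1 hiA)
    gcongr
    rw [hset]
    exact unspanned_insert_le J.M q _ J.ground (by simp [hi₁])
  · simp [hiA]

open Classical in
/-- If the selected order is good up to a probability `n δ`, then every element is selected often
enough. -/
theorem le_jointLaw {θ δ : ℝ≥0∞}
    (h : ∀ S : Finset (Fin n), S.Nonempty → (mean (scoreLaw J q c₁ c₂ S m) fun sc =>
      if ∃ e ∈ S, pick S sc = e ∧ θ * activeProb J e ≤ freeProb J q S e then 0 else 1) ≤ δ)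
    (i : Fin n) :
    (1 - n * δ) * (ENNReal.ofReal q * (θ * activeProb J i)) ≤
      (jointLaw J q c₁ c₂ m).toOuterMeasure {ω | i ∈ ω.2 ∧ i ∈ ω.1} := by
  classical
  have hbad := mean_not_goodOrder_le J q c₁ c₂ m h le_rfl
  have hgood : 1 - n * δ ≤ mean (orderLaw J q c₁ c₂ m n) fun l =>
      if GoodOrder J q θ l then 1 else 0 := by
    refine tsub_le_iff_right.2 (le_trans ?_ (add_le_add le_rfl hbad))
    rw [← mean_add]
    refine (mean_const (orderLaw J q c₁ c₂ m n) 1).symm.le.trans (mean_mono fun l => ?_)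
    split_ifs <;> simp
  rw [← mean_ite, jointLaw, mean_bind, mul_comm]
  refine (mul_le_mul_right hgood _).trans ?_
  rw [← mean_const_mul]
  refine mean_mono_support fun l hl => ?_
  obtain ⟨h1, h2⟩ := support_orderLaw J q c₁ c₂ m le_rfl hl
  split_ifs with hg
  · rw [mul_one, mean_bind]
    simp only [mean_map]
    exact le_mean_selected_of_goodOrder J q h1 h2 hg i
  · simp

end Order

/-! ### Simulation of an abstract process by a program -/

section Sim

variable {n : ℕ} (J : Instance n) (tD tM : ℕ)

/-- The program `c`, started in memory `s`, simulates the discrete law `p`: the outcome of `p` and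
the final memory can be coupled so that they are related by `R`, and every execution takes time at
most `B`. -/
def Sim {X : Type} (p : PMF X) (c : Prog) (s : Store) (R : X → Store → Prop) (B : ℕ) : Prop :=
  Coupled p (c.run J s) fun x r => R x r.1 ∧ r.2.time tD tM ≤ B

theorem Cost.time_add (a b : Cost) : (a + b).time tD tM = a.time tD tM + b.time tD tM := by
  change a.steps + b.steps + (a.samples + b.samples) * tD + (a.queries + b.queries) * tM = _
  unfold Cost.time
  ring

theorem Cost.time_ofSteps (k : ℕ) : (Cost.ofSteps k).time tD tM = k := by
  simp [Cost.ofSteps, Cost.time]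

theorem Cost.time_zero : (0 : Cost).time tD tM = 0 := Cost.time_ofSteps tD tM 0

namespace Sim

variable {J tD tM} {X Y : Type} {p : PMF X} {c c' : Prog} {s : Store} {R : X → Store → Prop}
  {B B' : ℕ}

theorem mono {R' : X → Store → Prop} (h : Sim J tD tM p c s R B)
    (hR : ∀ x s', R x s' → R' x s') (hB : B ≤ B') : Sim J tD tM p c s R' B' :=
  Coupled.mono h fun _ _ hr => ⟨hR _ _ hr.1, hr.2.trans hB⟩

theorem seq {f : X → PMF Y} {R' : Y → Store → Prop} (h : Sim J tD tM p c s R B)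
    (h' : ∀ x s', R x s' → Sim J tD tM (f x) c' s' R' B') :
    Sim J tD tM (p.bind f) (c.seq c') s R' (B + B') :=
  Coupled.bind h fun x r hr => (h' x r.1 hr.1).map_right fun y r' hr' =>
    ⟨hr'.1, by rw [Cost.time_add]; exact add_le_add hr.2 hr'.2⟩

theorem seq_map {f : X → Y} {R' : Y → Store → Prop} (h : Sim J tD tM p c s R B)
    (h' : ∀ x s', R x s' → Sim J tD tM (PMF.pure (f x)) c' s' R' B') :
    Sim J tD tM (p.map f) (c.seq c') s R' (B + B') := by
  rw [← PMF.bind_pure_comp]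
  exact h.seq h'

theorem seq_pure {x : X} {q : PMF Y} {R' : Y → Store → Prop}
    (h : Sim J tD tM (PMF.pure x) c s R B) (h' : ∀ s', R x s' → Sim J tD tM q c' s' R' B') :
    Sim J tD tM q (c.seq c') s R' (B + B') := by
  have := Sim.seq (R := fun y s' => y = x ∧ R x s') (f := fun _ => q) (c := c) (s := s)
    (p := PMF.pure x) (B := B) (R' := R') (c' := c') (B' := B') (J := J) (tD := tD) (tM := tM) ?_
    fun _ s' hs => h' s' hs.2
  · rwa [PMF.bind_const] at this
  · obtain ⟨γ, h1, h2, h3⟩ := h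
    refine ⟨γ, h1, h2, fun z hz => ?_⟩
    have hz1 : z.1 ∈ (PMF.pure x).support := by
      rw [← h1]
      exact (PMF.mem_support_map_iff _ _ _).2 ⟨z, hz, rfl⟩
    rw [PMF.support_pure, Set.mem_singleton_iff] at hz1
    exact ⟨⟨hz1, hz1 ▸ (h3 z hz).1⟩, (h3 z hz).2⟩

theorem skip {x : X} (h : R x s) : Sim J tD tM (PMF.pure x) .skip s R 1 :=
  Coupled.pure ⟨h, (Cost.time_ofSteps tD tM 1).le⟩

theorem assign {x : X} {v : ℕ} {e : Expr} (h : R x (s.setReg v (e.eval s))) :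
    Sim J tD tM (PMF.pure x) (.assign v e) s R (e.size + 1) :=
  Coupled.pure ⟨h, (Cost.time_ofSteps tD tM _).le⟩

theorem store {x : X} {a : ℕ} {i e : Expr} (h : R x (s.setCell a (i.eval s) (e.eval s))) :
    Sim J tD tM (PMF.pure x) (.store a i e) s R (i.size + e.size + 1) :=
  Coupled.pure ⟨h, (Cost.time_ofSteps tD tM _).le⟩

theorem assign_seq {v : ℕ} {e : Expr} (h : Sim J tD tM p c (s.setReg v (e.eval s)) R B) :
    Sim J tD tM p (.seq (.assign v e) c) s R (e.size + 1 + B) :=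
  seq_pure (x := ()) (R := fun _ s' => s' = s.setReg v (e.eval s)) (assign rfl) fun _ hs => hs ▸ h

theorem store_seq {a : ℕ} {i e : Expr}
    (h : Sim J tD tM p c (s.setCell a (i.eval s) (e.eval s)) R B) :
    Sim J tD tM p (.seq (.store a i e) c) s R (i.size + e.size + 1 + B) :=
  seq_pure (x := ()) (R := fun _ s' => s' = s.setCell a (i.eval s) (e.eval s)) (store rfl)
    fun _ hs => hs ▸ h

open Classical in
theorem member_seq {v a : ℕ} (h : Sim J tD tM p c
      (s.setReg v (if J.M.Indep (s.setOf n a : Set (Fin n)) then 1 else 0)) R B) :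
    Sim J tD tM p (.seq (.member v a) c) s R (1 + tM + B) :=
  seq_pure (x := ()) (c := .member v a)
    (R := fun _ s' => s' = s.setReg v (if J.M.Indep (s.setOf n a : Set (Fin n)) then 1 else 0))
    (Coupled.pure ⟨rfl, by simp [Cost.time]⟩) fun _ hs => hs ▸ h

theorem coin {v : ℕ} {q : unitInterval} :
    Sim J tD tM (biasedCoin q) (.coin v q) s (fun b s' => s' = s.setReg v (if b then 1 else 0)) 1 :=
  (Coupled.refl _).map_right fun x y hxy => by
    subst hxy
    exact ⟨rfl, (Cost.time_ofSteps tD tM 1).le⟩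

theorem sample {a : ℕ} :
    Sim J tD tM J.D (.sample a) s (fun A s' => s' = s.setArr a (indicator A)) (1 + tD) :=
  (Coupled.refl _).map_right fun x y hxy => by
    subst hxy
    exact ⟨rfl, by simp [Cost.time]⟩

theorem cond {e : Expr} (h1 : e.eval s ≠ 0 → Sim J tD tM p c s R B)
    (h2 : e.eval s = 0 → Sim J tD tM p c' s R B) :
    Sim J tD tM p (.cond e c c') s R (e.size + 1 + B) := by
  have h : Coupled p (if e.eval s ≠ 0 then c.run J s else c'.run J s)
      fun x r => R x r.1 ∧ r.2.time tD tM ≤ B := by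
    split_ifs with he
    · exact h1 he
    · exact h2 (not_not.1 he)
  exact h.map_right fun x r hr =>
    ⟨hr.1, by rw [Cost.time_add, Cost.time_ofSteps]; exact Nat.add_le_add_left hr.2 _⟩

/-- A loop simulates a process that makes one step in each round. -/
theorem loop {v N : ℕ} {e : Expr} {law : ℕ → PMF X} {step : ℕ → X → PMF X} {x₀ : X}
    {R : ℕ → X → Store → Prop} (hN : e.eval s = N) (h0 : law 0 = PMF.pure x₀)
    (hs : ∀ k < N, law (k + 1) = (law k).bind (step k)) (hR : R 0 x₀ s)
    (hbody : ∀ k < N, ∀ x s', R k x s' →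
      Sim J tD tM (step k x) c (s'.setReg v k) (R (k + 1)) B) :
    Sim J tD tM (law N) (.loop v e c) s (R N) (e.size + 1 + N * (B + 1)) := by
  have key : ∀ k ≤ N, Coupled (law k) (loopRun (c.run J) v k s)
      fun x r => R k x r.1 ∧ r.2.time tD tM ≤ k * (B + 1) := by
    intro k hk
    induction k with
    | zero =>
      rw [h0]
      exact Coupled.pure ⟨hR, by rw [Cost.time_zero]; exact Nat.zero_le _⟩
    | succ k ih =>
      rw [hs k hk]
      exact (ih (Nat.le_of_succ_le hk)).bind fun x r hr =>
        (hbody k hk x r.1 hr.1).map_right fun y r' hr' => ⟨hr'.1, by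
          rw [Cost.time_add, Cost.time_add, Cost.time_ofSteps]
          have h1 := hr.2
          have h2 := hr'.2
          calc _ ≤ k * (B + 1) + B + 1 := by omega
            _ = _ := by ring⟩
  have h := key N le_rfl
  unfold Sim
  rw [Prog.run, hN]
  exact h.map_right fun x r hr =>
    ⟨hr.1, by rw [Cost.time_add, Cost.time_ofSteps]; exact Nat.add_le_add_left hr.2 _⟩

theorem loop_pure {v N : ℕ} {e : Expr} {x : X} {R : ℕ → Store → Prop} (hN : e.eval s = N)
    (hR : R 0 s) (hbody : ∀ k < N, ∀ s', R k s' →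
      Sim J tD tM (PMF.pure x) c (s'.setReg v k) (fun _ => R (k + 1)) B) :
    Sim J tD tM (PMF.pure x) (.loop v e c) s (fun _ => R N) (e.size + 1 + N * (B + 1)) :=
  loop (law := fun _ => PMF.pure x) (step := fun _ _ => PMF.pure x) (R := fun k _ => R k) hN rfl
    (fun k _ => by rw [PMF.bind_const]) hR fun k hk _ s' hs' => hbody k hk s' hs'

end Sim

end Sim

@[simp]
theorem Store.setReg_reg (s : Store) (x v y : ℕ) :
    (s.setReg x v).reg y = if y = x then v else s.reg y := by
  simp [Store.setReg, Function.update_apply]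

@[simp]
theorem Store.setReg_arr (s : Store) (x v : ℕ) : (s.setReg x v).arr = s.arr := rfl

@[simp]
theorem Store.setCell_reg (s : Store) (a i v : ℕ) : (s.setCell a i v).reg = s.reg := rfl

@[simp]
theorem Store.setCell_arr (s : Store) (a i v b k : ℕ) :
    (s.setCell a i v).arr b k = if b = a ∧ k = i then v else s.arr b k := by
  by_cases hb : b = a
  · subst hb
    simp [Store.setCell, Function.update_apply]
  · simp [Store.setCell, hb]

@[simp]
theorem Store.setArr_reg (s : Store) (a : ℕ) (f : ℕ → ℕ) : (s.setArr a f).reg = s.reg := rfl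

@[simp]
theorem Store.setArr_arr (s : Store) (a : ℕ) (f : ℕ → ℕ) (b k : ℕ) :
    (s.setArr a f).arr b k = if b = a then f k else s.arr b k := by
  by_cases hb : b = a
  · subst hb
    simp [Store.setArr]
  · simp [Store.setArr, hb]

/-- The function `f`, restricted to `[n]`, is the indicator function of `T`. -/
def IsIndicator {n : ℕ} (T : Finset (Fin n)) (f : ℕ → ℕ) : Prop :=
  ∀ j : Fin n, f j = if j ∈ T then 1 else 0

theorem isIndicator_indicator {n : ℕ} (A : Finset (Fin n)) : IsIndicator A (indicator A) := by
  intro j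
  have : (∃ i ∈ A, (i : ℕ) = j) ↔ j ∈ A :=
    ⟨fun ⟨i, hi, h⟩ => Fin.ext h ▸ hi, fun h => ⟨j, h, rfl⟩⟩
  simp [indicator, this]

theorem Store.setOf_eq {n : ℕ} {s : Store} {a : ℕ} {T : Finset (Fin n)}
    (h : IsIndicator T (s.arr a)) : s.setOf n a = T := by
  ext j
  simp [Store.setOf, h j]

/-! ### The program that processes one sample -/

/-!
The memory is used as follows. Array `0` receives the order, array `1` a sample, array `2` an
independent set; arrays `3` and `4` hold the gains and the losses, and array `5` flags the elements
that have a position. Register `8` holds the number of samples per position, register `9` the number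
of positions that are filled; registers `10` and `11` count rounds, and register `14` holds the
chosen element. The other registers are auxiliary.
-/

/-- Restrict the sample in array `1` to the elements that are not flagged in array `5`, and clear
array `2`. -/
def restrictProg : Prog :=
  .loop 11 (.reg 0)
    (.seq (.store 1 (.reg 11) (.sub (.get 1 (.reg 11)) (.get 5 (.reg 11))))
      (.store 2 (.reg 11) (.const 0)))

/-- Select greedily, with coins, an independent subset of the set in array `1`, into array `2`. For
numbers `a, b ≤ 1` the conjunction is `a + b - 1`. -/
def greedyProg (q : unitInterval) : Prog :=
  .loop 11 (.reg 0)
    (.seq (.coin 12 q)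
      (.seq (.store 2 (.reg 11) (.sub (.add (.reg 12) (.get 1 (.reg 11))) (.const 1)))
        (.seq (.member 13 2)
          (.store 2 (.reg 11) (.sub (.add (.get 2 (.reg 11)) (.reg 13)) (.const 1))))))

/-- Update the gains in array `3` and the losses in array `4`: an element of the set in array `1` is
not spanned by the independent set in array `2` if and only if it does not belong to that set and
can be added to it. -/
def scoreProg (c₁ c₂ : ℕ) : Prog :=
  .loop 11 (.reg 0)
    (.seq (.assign 12 (.get 2 (.reg 11)))
      (.seq (.store 2 (.reg 11) (.const 1))
        (.seq (.member 13 2)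
          (.seq (.store 2 (.reg 11) (.reg 12))
            (.cond (.get 1 (.reg 11))
              (.cond (.sub (.reg 13) (.reg 12))
                (.store 3 (.reg 11) (.add (.get 3 (.reg 11)) (.const c₁)))
                (.store 4 (.reg 11) (.add (.get 4 (.reg 11)) (.const c₂))))
              .skip)))))

/-- Draw a sample of the prior and update the scores of the elements that are not flagged. -/
def sampleProg (q : unitInterval) (c₁ c₂ : ℕ) : Prog :=
  .seq (.sample 1) (.seq restrictProg (.seq (greedyProg q) (scoreProg c₁ c₂)))

section SampleProg

variable {n : ℕ} {J : Instance n} {tD tM : ℕ} {q : unitInterval} {c₁ c₂ : ℕ}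

/-- What the processing of a sample leaves unchanged: registers `0`, `8`, `9`, and arrays
`0`, `5`. -/
structure Frame (s s' : Store) : Prop where
  reg0 : s'.reg 0 = s.reg 0
  reg8 : s'.reg 8 = s.reg 8
  reg9 : s'.reg 9 = s.reg 9
  arr0 : s'.arr 0 = s.arr 0
  arr5 : s'.arr 5 = s.arr 5

theorem Frame.refl (s : Store) : Frame s s := ⟨rfl, rfl, rfl, rfl, rfl⟩

/-- The gains are in array `3` and the losses in array `4`. -/
def HoldsScores (sc : Scores n) (s : Store) : Prop :=
  ∀ j : Fin n, s.arr 3 j = (sc j).1 ∧ s.arr 4 j = (sc j).2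

theorem sim_restrictProg {s s₀ : Store} {S A : Finset (Fin n)} {sc : Scores n}
    (hn : s₀.reg 0 = n) (hS : ∀ j : Fin n, s₀.arr 5 j = if j ∈ S then 0 else 1)
    (hf : Frame s₀ s) (hsc : HoldsScores sc s) (hA : IsIndicator A (s.arr 1)) :
    Sim J tD tM (PMF.pure ()) restrictProg s
      (fun _ s' => Frame s₀ s' ∧ HoldsScores sc s' ∧ IsIndicator (A ∩ S) (s'.arr 1) ∧
        IsIndicator (∅ : Finset (Fin n)) (s'.arr 2)) (2 + n * 11) := by
  unfold restrictProg
  refine (Sim.loop_pure (N := n) (R := fun k s' => Frame s₀ s' ∧ HoldsScores sc s' ∧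
    ∀ j : Fin n, if (j : ℕ) < k
      then s'.arr 1 j = (if j ∈ A ∩ S then 1 else 0) ∧ s'.arr 2 j = 0
      else s'.arr 1 j = if j ∈ A then 1 else 0) (by simpa [Expr.eval] using hf.reg0.trans hn)
    ⟨hf, hsc, fun j => by simpa using hA j⟩ ?_ (B := 10)).mono ?_ (by simp [Expr.size])
  · rintro k hk s' ⟨hf', hsc', h'⟩
    refine (Sim.store_seq (Sim.store ?_)).mono (R := fun _ => _) (fun _ _ h => h)
      (by simp [Expr.size])
    refine ⟨⟨?_, ?_, ?_, ?_, ?_⟩, fun j => ?_, fun j => ?_⟩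
    · simpa using hf'.reg0
    · simpa using hf'.reg8
    · simpa using hf'.reg9
    · funext i; simpa using congrFun hf'.arr0 i
    · funext i; simpa using congrFun hf'.arr5 i
    · simpa using hsc' j
    · have hj := h' j
      simp only [Expr.eval, Store.setCell_arr, Store.setReg_reg, Store.setReg_arr,
        Store.setCell_reg, if_true]
      rcases lt_trichotomy (j : ℕ) k with h | h | h
      · rw [if_pos h] at hj
        rw [if_pos (by omega)]
        simpa [h.ne] using hj
      · rw [if_neg (by omega)] at hj
        rw [if_pos (by omega)]
        have h5 : s'.arr 5 k = if j ∈ S then 0 else 1 := by rw [hf'.arr5, ← h, hS j]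
        rw [h] at hj
        simp [h, hj, h5]
        by_cases h1 : j ∈ A <;> by_cases h2 : j ∈ S <;> simp [h1, h2]
      · rw [if_neg (by omega)] at hj
        rw [if_neg (by omega)]
        simpa [h.ne'] using hj
  · rintro - s' ⟨h1, h2, h3⟩
    refine ⟨h1, h2, fun j => ?_, fun j => ?_⟩
    · have := h3 j
      rw [if_pos j.2] at this
      exact this.1
    · have := h3 j
      rw [if_pos j.2] at this
      simpa using this.2

theorem take_finRange_succ {k : ℕ} (hk : k < n) :
    (List.finRange n).take (k + 1) = (List.finRange n).take k ++ [⟨k, hk⟩] := by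
  rw [List.take_succ_eq_append_getElem (by simpa using hk)]
  simp

theorem sim_greedyProg {s s₀ : Store} {T : Finset (Fin n)} {sc : Scores n}
    (hn : s₀.reg 0 = n) (hf : Frame s₀ s) (hsc : HoldsScores sc s)
    (hT : IsIndicator T (s.arr 1)) (h2 : IsIndicator (∅ : Finset (Fin n)) (s.arr 2)) :
    Sim J tD tM (greedyLaw J.M q T (List.finRange n) ∅) (greedyProg q) s
      (fun X s' => Frame s₀ s' ∧ HoldsScores sc s' ∧ IsIndicator T (s'.arr 1) ∧
        IsIndicator X (s'.arr 2) ∧ J.M.Indep (X : Set (Fin n))) (2 + n * (19 + tM)) := by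
  classical
  have key := Sim.loop (J := J) (tD := tD) (tM := tM) (s := s) (v := 11) (e := .reg 0) (N := n)
    (law := fun k => greedyLaw J.M q T ((List.finRange n).take k) ∅)
    (step := fun k X => if h : k < n then greedyStep J.M q T ⟨k, h⟩ X else PMF.pure X)
    (x₀ := ∅) (B := 18 + tM)
    (c := .seq (.coin 12 q)
      (.seq (.store 2 (.reg 11) (.sub (.add (.reg 12) (.get 1 (.reg 11))) (.const 1)))
        (.seq (.member 13 2)
          (.store 2 (.reg 11) (.sub (.add (.get 2 (.reg 11)) (.reg 13)) (.const 1))))))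
    (R := fun k X s' => Frame s₀ s' ∧ HoldsScores sc s' ∧ IsIndicator T (s'.arr 1) ∧
        IsIndicator X (s'.arr 2) ∧ J.M.Indep (X : Set (Fin n)) ∧ ∀ j ∈ X, (j : ℕ) < k)
    (by simpa [Expr.eval] using hf.reg0.trans hn) (by simp [greedyLaw]) ?_
    ⟨hf, hsc, hT, h2, by simp, by simp⟩ ?_
  · rw [List.take_of_length_le (by simp)] at key
    refine key.mono ?_ (by simp only [Expr.size]; nlinarith)
    rintro X s' ⟨a, b, c, d, e, -⟩
    exact ⟨a, b, c, d, e⟩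
  · intro k hk
    simp only [hk, dif_pos]
    rw [take_finRange_succ hk, greedyLaw_concat]
  · rintro k hk X s' ⟨hf', hsc', hT', hX, hi, hlt⟩
    simp only [hk, dif_pos]
    have hkX : (⟨k, hk⟩ : Fin n) ∉ X := fun h => lt_irrefl k (hlt _ h)
    refine (Sim.seq_map Sim.coin (B' := 17 + tM) fun b s'' hs'' => ?_).mono (fun _ _ h => h)
      (by omega)
    subst hs''
    refine (Sim.store_seq (Sim.member_seq (Sim.store ?_))).mono (R := fun _ => _) (fun _ _ h => h)
      (by simp only [Expr.size]; omega)
    -- the candidate set whose independence is tested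
    have hcand : IsIndicator (if b = true ∧ (⟨k, hk⟩ : Fin n) ∈ T then insert ⟨k, hk⟩ X else X)
        ((((s'.setReg 11 k).setReg 12 (if b = true then 1 else 0)).setCell 2 k
          ((if b = true then 1 else 0) + s'.arr 1 k - 1)).arr 2) := by
      intro j
      have hTk := hT' ⟨k, hk⟩
      have hXj := hX j
      simp only at hTk
      simp only [Store.setCell_arr, Store.setReg_arr, hTk]
      by_cases hjk : (j : ℕ) = k
      · have hj : j = ⟨k, hk⟩ := Fin.ext hjk
        subst hj
        cases b <;> by_cases hkT : (⟨k, hk⟩ : Fin n) ∈ T <;> simp [hkT, hkX]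
      · have hj : j ≠ ⟨k, hk⟩ := fun h => hjk (congrArg Fin.val h)
        simp only [hjk, and_false, if_false]
        rw [hXj]
        split_ifs <;> simp_all
    have hset := Store.setOf_eq hcand
    have hTk := hT' ⟨k, hk⟩
    simp only at hTk
    simp only [Expr.eval, Store.setReg_reg, Store.setReg_arr, Store.setCell_reg, if_true,
      show (11 : ℕ) ≠ 12 by decide, show (11 : ℕ) ≠ 13 by decide, if_false, hset]
    refine ⟨⟨?_, ?_, ?_, ?_, ?_⟩, fun j => ?_, fun j => ?_, fun j => ?_, ?_, fun j hj => ?_⟩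
    · simpa using hf'.reg0
    · simpa using hf'.reg8
    · simpa using hf'.reg9
    · funext i; simpa using congrFun hf'.arr0 i
    · funext i; simpa using congrFun hf'.arr5 i
    · simpa using hsc' j
    · simpa using hT' j
    · have hXj := hX j
      simp only [Store.setCell_arr, Store.setReg_arr, hTk]
      by_cases hjk : (j : ℕ) = k
      · have hj : j = ⟨k, hk⟩ := Fin.ext hjk
        subst hj
        cases b <;> by_cases hkT : (⟨k, hk⟩ : Fin n) ∈ T <;>
          by_cases hin : J.M.Indep (insert ⟨k, hk⟩ X : Finset (Fin n)) <;>
          simp_all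
      · have hj : j ≠ ⟨k, hk⟩ := fun h => hjk (congrArg Fin.val h)
        simp only [hjk, and_false, if_false, hXj]
        split_ifs <;> simp_all
    · split_ifs with h
      · exact h.2.2
      · exact hi
    · split_ifs at hj
      · rcases Finset.mem_insert.1 hj with rfl | hj
        · exact Nat.lt_succ_self k
        · exact (hlt j hj).trans (Nat.lt_succ_self k)
      · exact (hlt j hj).trans (Nat.lt_succ_self k)

theorem sim_scoreProg {s s₀ : Store} {T X : Finset (Fin n)} {sc : Scores n}
    (hn : s₀.reg 0 = n) (hf : Frame s₀ s) (hsc : HoldsScores sc s)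
    (hT : IsIndicator T (s.arr 1)) (hX : IsIndicator X (s.arr 2))
    (hi : J.M.Indep (X : Set (Fin n))) :
    Sim J tD tM (PMF.pure (updateScores J c₁ c₂ T X sc)) (scoreProg c₁ c₂) s
      (fun sc' s' => Frame s₀ s' ∧ HoldsScores sc' s') (2 + n * (24 + tM)) := by
  classical
  refine (Sim.loop (J := J) (tD := tD) (tM := tM) (N := n)
    (law := fun _ => PMF.pure (updateScores J c₁ c₂ T X sc)) (step := fun _ x => PMF.pure x)
    (B := 23 + tM) (R := fun k sc' s' => sc' = updateScores J c₁ c₂ T X sc ∧ Frame s₀ s' ∧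
      IsIndicator T (s'.arr 1) ∧ IsIndicator X (s'.arr 2) ∧
      ∀ j : Fin n, if (j : ℕ) < k then s'.arr 3 j = (sc' j).1 ∧ s'.arr 4 j = (sc' j).2
        else s'.arr 3 j = (sc j).1 ∧ s'.arr 4 j = (sc j).2)
    (by simpa [Expr.eval] using hf.reg0.trans hn) rfl (fun k _ => by rw [PMF.bind_pure])
    ⟨rfl, hf, hT, hX, fun j => by simpa using hsc j⟩ ?_).mono ?_
    (by simp only [Expr.size]; nlinarith)
  · rintro k hk sc' s' ⟨rfl, hf', hT', hX', h'⟩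
    have hcl : (⟨k, hk⟩ : Fin n) ∉ J.M.closure X ↔
        J.M.Indep (insert ⟨k, hk⟩ X : Finset (Fin n)) ∧ (⟨k, hk⟩ : Fin n) ∉ X := by
      rw [hi.notMem_closure_iff (by rw [J.ground]; trivial)]
      push_cast
      rfl
    have hcand : IsIndicator (insert ⟨k, hk⟩ X)
        ((((s'.setReg 11 k).setReg 12 (s'.arr 2 k)).setCell 2 k 1).arr 2) := by
      intro j
      simp only [Store.setCell_arr, Store.setReg_arr]
      by_cases hjk : (j : ℕ) = k
      · have hj : j = ⟨k, hk⟩ := Fin.ext hjk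
        simp [hj]
      · have hj : j ≠ ⟨k, hk⟩ := fun h => hjk (congrArg Fin.val h)
        simp [hjk, hj, hX' j]
    have hset := Store.setOf_eq hcand
    have hTk := hT' ⟨k, hk⟩
    have hXk := hX' ⟨k, hk⟩
    have hsck := h' ⟨k, hk⟩
    simp only at hTk hXk
    rw [if_neg (lt_irrefl k)] at hsck
    simp only at hsck
    -- the memory is described cell by cell, whatever the tests give
    have hpost : ∀ (u₃ u₄ : ℕ) (s'' : Store), Frame s' s'' →
        (∀ i, s''.arr 1 i = s'.arr 1 i) → (∀ i, s''.arr 2 i = s'.arr 2 i) →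
        (∀ i, s''.arr 3 i = if i = k then u₃ else s'.arr 3 i) →
        (∀ i, s''.arr 4 i = if i = k then u₄ else s'.arr 4 i) →
        u₃ = (updateScores J c₁ c₂ T X sc ⟨k, hk⟩).1 →
        u₄ = (updateScores J c₁ c₂ T X sc ⟨k, hk⟩).2 →
        (updateScores J c₁ c₂ T X sc = updateScores J c₁ c₂ T X sc ∧ Frame s₀ s'' ∧
          IsIndicator T (s''.arr 1) ∧ IsIndicator X (s''.arr 2) ∧
          ∀ j : Fin n, if (j : ℕ) < k + 1 then
            s''.arr 3 j = (updateScores J c₁ c₂ T X sc j).1 ∧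
              s''.arr 4 j = (updateScores J c₁ c₂ T X sc j).2
            else s''.arr 3 j = (sc j).1 ∧ s''.arr 4 j = (sc j).2) := by
      intro u₃ u₄ s'' f e1 e2 e3 e4 hu₃ hu₄
      refine ⟨rfl, ⟨f.reg0.trans hf'.reg0, f.reg8.trans hf'.reg8, f.reg9.trans hf'.reg9,
        f.arr0.trans hf'.arr0, f.arr5.trans hf'.arr5⟩, fun j => (e1 j).trans (hT' j),
        fun j => (e2 j).trans (hX' j), fun j => ?_⟩
      have hj := h' j
      rw [e3, e4]
      rcases lt_trichotomy (j : ℕ) k with h | h | h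
      · rw [if_pos h] at hj
        rw [if_pos (by omega), if_neg h.ne, if_neg h.ne]
        exact hj
      · obtain rfl : j = ⟨k, hk⟩ := Fin.ext h
        rw [if_pos (by simp)]
        simpa using ⟨hu₃, hu₄⟩
      · rw [if_neg (by omega)] at hj
        rw [if_neg (by omega), if_neg h.ne', if_neg h.ne']
        exact hj
    have hback : ∀ i, (if i = k then s'.arr 2 k else if i = k then 1 else s'.arr 2 i) =
        s'.arr 2 i := by
      intro i
      split_ifs with h
      · rw [h]
      · rfl
    refine (Sim.assign_seq (Sim.store_seq (Sim.member_seq (Sim.store_seq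
      (Sim.cond (B := 10) (fun hact => (Sim.cond (B := 6)
        (fun hev => (Sim.store ?_).mono (R := fun _ => _) (fun _ _ h => h) (by simp [Expr.size]))
        (fun hev => (Sim.store ?_).mono (R := fun _ => _) (fun _ _ h => h)
          (by simp [Expr.size]))).mono (R := fun _ => _) (fun _ _ h => h) (by simp [Expr.size]))
        (fun hact => (Sim.skip ?_).mono (R := fun _ => _) (fun _ _ h => h) (by simp))))))).mono
        (R := fun _ => _) (fun _ _ h => h) (by simp only [Expr.size]; omega)
    · have hkT : (⟨k, hk⟩ : Fin n) ∈ T := by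
        by_contra h
        simp [Expr.eval, hTk, h] at hact
      have hfree : (⟨k, hk⟩ : Fin n) ∉ J.M.closure X := by
        rw [hcl]
        simp only [Expr.eval, Store.setReg_reg, Store.setReg_arr, Store.setCell_reg, if_true,
          show (11 : ℕ) ≠ 12 by decide, if_false, hset] at hev
        simp only [hXk] at hev
        by_contra h
        split_ifs at hev <;> simp_all
      have hu : updateScores J c₁ c₂ T X sc ⟨k, hk⟩ = ((sc ⟨k, hk⟩).1 + c₁, (sc ⟨k, hk⟩).2) := by
        rw [updateScores, if_pos hkT, if_neg hfree]
      refine hpost ((sc ⟨k, hk⟩).1 + c₁) (s'.arr 4 k) _ ⟨?_, ?_, ?_, ?_, ?_⟩ ?_ ?_ ?_ ?_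
        (by rw [hu]) (by rw [hu, hsck.2])
      all_goals first | funext i | intro i | skip
      all_goals simp [Expr.eval, hback, hsck.1]
      rintro rfl
      rfl
    · have hkT : (⟨k, hk⟩ : Fin n) ∈ T := by
        by_contra h
        simp [Expr.eval, hTk, h] at hact
      have hfree : (⟨k, hk⟩ : Fin n) ∈ J.M.closure X := by
        by_contra h
        rw [hcl] at h
        simp only [Expr.eval, Store.setReg_reg, Store.setReg_arr, Store.setCell_reg, if_true,
          show (11 : ℕ) ≠ 12 by decide, if_false, hset] at hev
        simp only [hXk, if_pos h.1, if_neg h.2] at hev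
        simp at hev
      have hu : updateScores J c₁ c₂ T X sc ⟨k, hk⟩ = ((sc ⟨k, hk⟩).1, (sc ⟨k, hk⟩).2 + c₂) := by
        rw [updateScores, if_pos hkT, if_pos hfree]
      refine hpost (s'.arr 3 k) ((sc ⟨k, hk⟩).2 + c₂) _ ⟨?_, ?_, ?_, ?_, ?_⟩ ?_ ?_ ?_ ?_
        (by rw [hu, hsck.1]) (by rw [hu])
      all_goals first | funext i | intro i | skip
      all_goals simp [Expr.eval, hback, hsck.2]
      rintro rfl
      rfl
    · have hkT : (⟨k, hk⟩ : Fin n) ∉ T := by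
        intro h
        simp [Expr.eval, hTk, h] at hact
      have hu : updateScores J c₁ c₂ T X sc ⟨k, hk⟩ = sc ⟨k, hk⟩ := by
        rw [updateScores, if_neg hkT]
      refine hpost (s'.arr 3 k) (s'.arr 4 k) _ ⟨?_, ?_, ?_, ?_, ?_⟩ ?_ ?_ ?_ ?_
        (by rw [hu, hsck.1]) (by rw [hu, hsck.2])
      all_goals first | funext i | intro i | skip
      all_goals simp [Expr.eval, hback]
      all_goals
        rintro rfl
        rfl
  · rintro sc' s' ⟨rfl, h1, -, -, h3⟩
    refine ⟨h1, fun j => ?_⟩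
    have := h3 j
    rwa [if_pos j.2] at this

theorem sim_sampleProg {s s₀ : Store} {S : Finset (Fin n)} {sc : Scores n}
    (hn : s₀.reg 0 = n) (hS : ∀ j : Fin n, s₀.arr 5 j = if j ∈ S then 0 else 1)
    (hf : Frame s₀ s) (hsc : HoldsScores sc s) :
    Sim J tD tM (sampleLaw J q c₁ c₂ S sc) (sampleProg q c₁ c₂) s
      (fun sc' s' => Frame s₀ s' ∧ HoldsScores sc' s') (tD + 7 + n * (54 + 2 * tM)) := by
  classical
  refine (Sim.seq Sim.sample (B' := 6 + n * (54 + 2 * tM)) fun A s₁ hs₁ => ?_).mono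
    (fun _ _ h => h) (by omega)
  have hf₁ : Frame s₀ s₁ := by
    subst hs₁
    exact ⟨hf.reg0, hf.reg8, hf.reg9, by funext i; simpa using congrFun hf.arr0 i,
      by funext i; simpa using congrFun hf.arr5 i⟩
  have hsc₁ : HoldsScores sc s₁ := by
    subst hs₁
    intro j
    simpa using hsc j
  have hA : IsIndicator A (s₁.arr 1) := by
    subst hs₁
    intro j
    simpa using isIndicator_indicator A j
  refine (Sim.seq_pure (sim_restrictProg hn hS hf₁ hsc₁ hA) fun s₂ h₂ =>
    Sim.seq_map (sim_greedyProg hn h₂.1 h₂.2.1 h₂.2.2.1 h₂.2.2.2) fun X s₃ h₃ =>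
      sim_scoreProg hn h₃.1 h₃.2.1 h₃.2.2.1 h₃.2.2.2.1 h₃.2.2.2.2).mono (fun _ _ h => h)
    (by nlinarith)

end SampleProg

/-! ### The program that selects the order -/

/-- Set all gains and losses to zero. -/
def clearProg : Prog :=
  .loop 11 (.reg 0)
    (.seq (.store 3 (.reg 11) (.const 0)) (.store 4 (.reg 11) (.const 0)))

/-- Put into register `14` the last element that is not flagged. -/
def lastProg : Prog :=
  .loop 11 (.reg 0) (.cond (.get 5 (.reg 11)) .skip (.assign 14 (.reg 11)))

/-- Put into register `14` the last unflagged element whose gains are at least its losses, if there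
is one. -/
def bestProg : Prog :=
  .loop 11 (.reg 0) (.cond (.get 5 (.reg 11)) .skip
    (.cond (.sub (.get 4 (.reg 11)) (.get 3 (.reg 11))) .skip (.assign 14 (.reg 11))))

/-- Choose the element for the position `n - 1 - k`, where `k` is in register `9`, and flag it. -/
def stageProg (q : unitInterval) (c₁ c₂ : ℕ) : Prog :=
  .seq clearProg
    (.seq (.loop 10 (.reg 8) (sampleProg q c₁ c₂))
      (.seq (.assign 14 (.const 0))
        (.seq lastProg
          (.seq bestProg
            (.seq (.store 0 (.sub (.sub (.reg 0) (.const 1)) (.reg 9)) (.reg 14))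
              (.store 5 (.reg 14) (.const 1)))))))

/-- Starting from register `6` at `L` and register `7` at `1`, double register `7` and increase
register `6` until register `7` is at least `n`. -/
def doubleProg : Prog :=
  .loop 11 (.reg 0) (.cond (.sub (.reg 0) (.reg 7))
    (.seq (.assign 7 (.add (.reg 7) (.reg 7))) (.assign 6 (.add (.reg 6) (.const 1)))) .skip)

/-- Compute the number of samples per stage, in register `8`, as the product of the constant `K`,
of `L + ⌈log₂ n⌉`, and of the number in register `1`. -/
def countProg (K L : ℕ) : Prog :=
  .seq (.assign 6 (.const L))
    (.seq (.assign 7 (.const 1))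
      (.seq doubleProg
        (.seq (.loop 11 (.reg 6) (.assign 15 (.add (.reg 15) (.const K))))
          (.loop 11 (.reg 1) (.assign 8 (.add (.reg 8) (.reg 15)))))))

/-- Fill array `0` from the back. -/
def selectProg (q : unitInterval) (c₁ c₂ K L : ℕ) : Prog :=
  .seq (countProg K L) (.loop 9 (.reg 0) (stageProg q c₁ c₂))

section SelectProg

variable {n : ℕ} {J : Instance n} {tD tM : ℕ} {q : unitInterval} {c₁ c₂ K L : ℕ}

/-- The number of samples per stage. -/
def sampleCount (J : Instance n) (K L : ℕ) : ℕ := ⌈1 / J.pMin⌉₊ * ((L + Nat.clog 2 n) * K)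

/-- The memory when the list `l` has been selected as a final segment of the order and `m` samples
are taken per stage. -/
structure HoldsSegment (m : ℕ) (l : List (Fin n)) (s : Store) : Prop where
  nodup : l.Nodup
  length_le : l.length ≤ n
  reg0 : s.reg 0 = n
  reg8 : s.reg 8 = m
  arr5 : ∀ j : Fin n, s.arr 5 j = if j ∈ remaining l then 0 else 1
  arr0 : ∀ (t : ℕ) (ht : t < l.length), s.arr 0 (n - l.length + t) = (l[t] : ℕ)

theorem sim_clearProg {s s₀ : Store} (hn : s₀.reg 0 = n) (hf : Frame s₀ s) :
    Sim J tD tM (PMF.pure ()) clearProg s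
      (fun _ s' => Frame s₀ s' ∧ HoldsScores (0 : Scores n) s') (2 + n * 7) := by
  unfold clearProg
  refine (Sim.loop_pure (N := n) (R := fun k s' => Frame s₀ s' ∧
    ∀ j < k, s'.arr 3 j = 0 ∧ s'.arr 4 j = 0) (by simpa [Expr.eval] using hf.reg0.trans hn)
    ⟨hf, fun j hj => absurd hj (Nat.not_lt_zero j)⟩ ?_ (B := 6)).mono
    (fun _ s' h => ⟨h.1, fun j => h.2 j j.2⟩) (by simp [Expr.size])
  rintro k hk s' ⟨hf', h'⟩
  refine (Sim.store_seq (Sim.store ?_)).mono (R := fun _ => _) (fun _ _ h => h)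
    (by simp [Expr.size])
  refine ⟨⟨?_, ?_, ?_, ?_, ?_⟩, fun j hj => ?_⟩
  · simpa using hf'.reg0
  · simpa using hf'.reg8
  · simpa using hf'.reg9
  · funext i; simpa using congrFun hf'.arr0 i
  · funext i; simpa using congrFun hf'.arr5 i
  · rcases Nat.lt_succ_iff_lt_or_eq.1 hj with h | rfl
    · simpa [Expr.eval, h.ne] using h' j h
    · simp [Expr.eval]

theorem sim_lastProg {s s₀ : Store} {S : Finset (Fin n)} {sc : Scores n} {d : ℕ}
    (hn : s₀.reg 0 = n) (hS : ∀ j : Fin n, s₀.arr 5 j = if j ∈ S then 0 else 1)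
    (hf : Frame s₀ s) (hsc : HoldsScores sc s) (hd : s.reg 14 = d) :
    Sim J tD tM (PMF.pure ()) lastProg s (fun _ s' => Frame s₀ s' ∧ HoldsScores sc s' ∧
      s'.reg 14 = lastOr (fun j => j ∈ S) d n) (2 + n * 6) := by
  unfold lastProg
  refine (Sim.loop_pure (N := n) (R := fun k s' => Frame s₀ s' ∧ HoldsScores sc s' ∧
    s'.reg 14 = lastOr (fun j => j ∈ S) d k) (by simpa [Expr.eval] using hf.reg0.trans hn)
    ⟨hf, hsc, hd⟩ ?_ (B := 5)).mono (fun _ s' h => h) (by simp [Expr.size])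
  rintro k hk s' ⟨hf', hsc', h'⟩
  have h5 := hS ⟨k, hk⟩
  simp only [← hf'.arr5] at h5
  refine (Sim.cond (B := 2) (fun h => (Sim.skip ?_).mono (R := fun _ => _) (fun _ _ h => h)
    (by simp)) (fun h => (Sim.assign ?_).mono (R := fun _ => _) (fun _ _ h => h)
    (by simp [Expr.size]))).mono (R := fun _ => _) (fun _ _ h => h) (by simp [Expr.size])
  · have hk' : (⟨k, hk⟩ : Fin n) ∉ S := by
      intro hk'
      simp [Expr.eval, h5, hk'] at h
    refine ⟨⟨hf'.reg0, hf'.reg8, hf'.reg9, hf'.arr0, hf'.arr5⟩, hsc', ?_⟩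
    rw [lastOr, if_neg fun h => hk' h.2]
    simpa using h'
  · have hk' : (⟨k, hk⟩ : Fin n) ∈ S := by
      by_contra hk'
      simp [Expr.eval, h5, hk'] at h
    refine ⟨⟨hf'.reg0, hf'.reg8, hf'.reg9, hf'.arr0, hf'.arr5⟩, hsc', ?_⟩
    rw [lastOr, if_pos ⟨hk, hk'⟩]
    simp [Expr.eval]

theorem sim_bestProg {s s₀ : Store} {S : Finset (Fin n)} {sc : Scores n} {d : ℕ}
    (hn : s₀.reg 0 = n) (hS : ∀ j : Fin n, s₀.arr 5 j = if j ∈ S then 0 else 1)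
    (hf : Frame s₀ s) (hsc : HoldsScores sc s) (hd : s.reg 14 = d) :
    Sim J tD tM (PMF.pure ()) bestProg s (fun _ s' => Frame s₀ s' ∧
      s'.reg 14 = lastOr (fun j => j ∈ S ∧ (sc j).2 ≤ (sc j).1) d n) (2 + n * 12) := by
  unfold bestProg
  refine (Sim.loop_pure (N := n) (R := fun k s' => Frame s₀ s' ∧ HoldsScores sc s' ∧
    s'.reg 14 = lastOr (fun j => j ∈ S ∧ (sc j).2 ≤ (sc j).1) d k)
    (by simpa [Expr.eval] using hf.reg0.trans hn)
    ⟨hf, hsc, hd⟩ ?_ (B := 11)).mono (fun _ s' h => ⟨h.1, h.2.2⟩) (by simp [Expr.size])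
  rintro k hk s' ⟨hf', hsc', h'⟩
  have h5 := hS ⟨k, hk⟩
  have hk3 := hsc' ⟨k, hk⟩
  simp only [← hf'.arr5] at h5
  simp only at hk3
  refine (Sim.cond (B := 8) (fun h => (Sim.skip ?_).mono (R := fun _ => _) (fun _ _ h => h)
    (by simp)) (fun h => (Sim.cond (B := 2) (fun h₂ => (Sim.skip ?_).mono (R := fun _ => _)
      (fun _ _ h => h) (by simp)) (fun h₂ => (Sim.assign ?_).mono (R := fun _ => _)
      (fun _ _ h => h) (by simp [Expr.size]))).mono (R := fun _ => _) (fun _ _ h => h)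
      (by simp [Expr.size]))).mono (R := fun _ => _) (fun _ _ h => h) (by simp [Expr.size])
  · have hk' : (⟨k, hk⟩ : Fin n) ∉ S := by
      intro hk'
      simp [Expr.eval, h5, hk'] at h
    refine ⟨⟨hf'.reg0, hf'.reg8, hf'.reg9, hf'.arr0, hf'.arr5⟩, hsc', ?_⟩
    rw [lastOr, if_neg fun h => hk' h.2.1]
    simpa using h'
  · refine ⟨⟨hf'.reg0, hf'.reg8, hf'.reg9, hf'.arr0, hf'.arr5⟩, hsc', ?_⟩
    rw [lastOr, if_neg fun h' => h₂ (by simp [Expr.eval, hk3]; exact Nat.sub_eq_zero_of_le h'.2.2)]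
    simpa using h'
  · have hk' : (⟨k, hk⟩ : Fin n) ∈ S := by
      by_contra hk'
      simp [Expr.eval, h5, hk'] at h
    refine ⟨⟨hf'.reg0, hf'.reg8, hf'.reg9, hf'.arr0, hf'.arr5⟩, hsc', ?_⟩
    simp [Expr.eval, hk3] at h₂
    rw [lastOr, if_pos ⟨hk, hk', by omega⟩]
    simp [Expr.eval]

theorem sim_stageProg {m k : ℕ} (hk : k < n) {l : List (Fin n)} (hl : l.length = k) {s : Store}
    (h : HoldsSegment m l s) :
    Sim J tD tM ((scoreLaw J q c₁ c₂ (remaining l) m).map fun sc =>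
        extend l (pick (remaining l) sc)) (stageProg q c₁ c₂) (s.setReg 9 k)
      (fun l' s' => l'.length = k + 1 ∧ HoldsSegment m l' s')
      (20 + n * 25 + m * (tD + 8 + n * (54 + 2 * tM))) := by
  set s₀ := s.setReg 9 k with hs₀
  have hn : s₀.reg 0 = n := by simpa [hs₀] using h.reg0
  have hS : ∀ j : Fin n, s₀.arr 5 j = if j ∈ remaining l then 0 else 1 := by
    simpa [hs₀] using h.arr5
  have hloop : ∀ s₁, Frame s₀ s₁ → HoldsScores (0 : Scores n) s₁ →
      Sim J tD tM (scoreLaw J q c₁ c₂ (remaining l) m) (.loop 10 (.reg 8) (sampleProg q c₁ c₂)) s₁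
        (fun sc s' => Frame s₀ s' ∧ HoldsScores sc s')
        (2 + m * (tD + 8 + n * (54 + 2 * tM))) := by
    intro s₁ hf₁ hsc₁
    refine (Sim.loop (law := scoreLaw J q c₁ c₂ (remaining l))
      (step := fun _ => sampleLaw J q c₁ c₂ (remaining l))
      (R := fun _ sc s' => Frame s₀ s' ∧ HoldsScores sc s') (N := m) ?_ rfl (fun _ _ => rfl)
      ⟨hf₁, hsc₁⟩ (fun i _ sc s' hs' => sim_sampleProg hn hS ?_ ?_)).mono (fun _ _ h => h) ?_
    · have := h.reg8
      simpa [Expr.eval, hs₀, this] using hf₁.reg8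
    · exact ⟨hs'.1.reg0, hs'.1.reg8, hs'.1.reg9, hs'.1.arr0, hs'.1.arr5⟩
    · exact hs'.2
    · simp only [Expr.size]
      apply le_of_eq
      ring
  refine (Sim.seq_pure (sim_clearProg hn (Frame.refl s₀)) fun s₁ h₁ =>
    Sim.seq_map (hloop s₁ h₁.1 h₁.2) (B' := 16 + n * 18) fun sc s₂ h₂ => ?_).mono (fun _ _ h => h)
    (by nlinarith)
  have hf₂ : Frame s₀ (s₂.setReg 14 (Expr.eval s₂ (.const 0))) :=
    ⟨h₂.1.reg0, h₂.1.reg8, h₂.1.reg9, h₂.1.arr0, h₂.1.arr5⟩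
  have hsc₂ : HoldsScores sc (s₂.setReg 14 (Expr.eval s₂ (.const 0))) := h₂.2
  refine (Sim.assign_seq (Sim.seq_pure (sim_lastProg (d := 0) hn hS hf₂ hsc₂
    (by simp [Expr.eval])) fun s₃ h₃ =>
    Sim.seq_pure (sim_bestProg hn hS h₃.1 h₃.2.1 h₃.2.2) fun s₄ h₄ =>
      Sim.store_seq (Sim.store ?_))).mono (R := fun _ => _) (fun _ _ h => h)
    (by simp only [Expr.size]; nlinarith)
  -- the chosen element is put in front of the segment
  obtain ⟨e, he, hpe, -⟩ := exists_pick_eq (remaining_nonempty (l := l) (by omega)) sc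
  have h14 : s₄.reg 14 = e := h₄.2.trans hpe
  have h9 : s₄.reg 9 = k := by rw [h₄.1.reg9]; simp [hs₀]
  have h0 : s₄.reg 0 = n := h₄.1.reg0.trans hn
  rw [hpe, extend_val]
  refine ⟨by simp [hl], ⟨List.nodup_cons.2 ⟨mem_remaining.1 he, h.nodup⟩, by simp; omega, ?_, ?_,
    fun j => ?_, fun t ht => ?_⟩⟩
  · simpa using h0
  · have := h₄.1.reg8
    simpa [hs₀, h.reg8] using this
  · have h5 := hS j
    rw [← h₄.1.arr5] at h5
    simp only [Expr.eval, Store.setCell_arr, Store.setCell_reg, h14, true_and]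
    by_cases hj : j = e
    · simp [hj, mem_remaining]
    · have hj' : (j : ℕ) ≠ e := fun h => hj (Fin.ext h)
      simp [hj', h5, mem_remaining, hj]
  · simp only [Expr.eval, Store.setCell_arr, Store.setCell_reg, h14, h9, h0, List.length_cons, hl]
    cases t with
    | zero => simp; omega
    | succ t =>
      have ht' : t < l.length := by simpa using ht
      have h0' := h.arr0 t ht'
      have harr : s₄.arr 0 = s.arr 0 := h₄.1.arr0
      rw [← harr, hl] at h0'
      simp only [List.getElem_cons_succ]
      rw [if_neg (by simp), if_neg (by omega), ← h0']
      congr 1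
      omega

theorem sim_doubleProg {s : Store} (hn : s.reg 0 = n) (h6 : s.reg 6 = L) (h7 : s.reg 7 = 1) :
    Sim J tD tM (PMF.pure ()) doubleProg s (fun _ s' => s'.reg 6 = L + Nat.clog 2 n ∧
      s'.reg 0 = n ∧ s'.reg 1 = s.reg 1 ∧ s'.reg 8 = s.reg 8 ∧ s'.reg 15 = s.reg 15 ∧
      s'.arr = s.arr) (2 + n * 13) := by
  unfold doubleProg
  refine (Sim.loop_pure (N := n) (R := fun k s' => s'.reg 6 = L + min k (Nat.clog 2 n) ∧
    s'.reg 7 = 2 ^ min k (Nat.clog 2 n) ∧ s'.reg 0 = n ∧ s'.reg 1 = s.reg 1 ∧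
    s'.reg 8 = s.reg 8 ∧ s'.reg 15 = s.reg 15 ∧ s'.arr = s.arr) (by simpa [Expr.eval] using hn)
    (by simp [hn, h6, h7]) ?_ (B := 12)).mono (fun _ s' h => ⟨?_, h.2.2⟩) (by simp [Expr.size])
  · rintro k hk s' ⟨a, b, c, d, e, f, g⟩
    refine (Sim.cond (B := 8) (fun h => (Sim.assign_seq (Sim.assign ?_)).mono (R := fun _ => _)
      (fun _ _ h => h) (by simp [Expr.size])) (fun h => (Sim.skip ?_).mono (R := fun _ => _)
      (fun _ _ h => h) (by simp))).mono (R := fun _ => _) (fun _ _ h => h) (by simp [Expr.size])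
    · have hlt : 2 ^ min k (Nat.clog 2 n) < n := by
        simp [Expr.eval, b, c] at h
        omega
      have h1 : min k (Nat.clog 2 n) < Nat.clog 2 n := (Nat.lt_clog_iff_pow_lt one_lt_two).2 hlt
      have h2 : min (k + 1) (Nat.clog 2 n) = min k (Nat.clog 2 n) + 1 := by omega
      rw [h2]
      simp [Expr.eval, a, b, c, d, e, f, g, pow_succ]
      omega
    · have hle : n ≤ 2 ^ min k (Nat.clog 2 n) := by
        simp [Expr.eval, b, c] at h
        omega
      have h1 : Nat.clog 2 n ≤ min k (Nat.clog 2 n) := (Nat.clog_le_iff_le_pow one_lt_two).2 hle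
      have h2 : min (k + 1) (Nat.clog 2 n) = min k (Nat.clog 2 n) := by omega
      rw [h2]
      simp [a, b, c, d, e, f, g]
  · rw [h.1, min_eq_right]
    exact (Nat.clog_le_iff_le_pow one_lt_two).2 Nat.lt_two_pow_self.le

theorem sim_countProg :
    Sim J tD tM (PMF.pure ()) (countProg K L) J.input
      (fun _ => HoldsSegment (sampleCount J K L) ([] : List (Fin n)))
      (10 + n * 13 + (L + Nat.clog 2 n) * 5 + ⌈1 / J.pMin⌉₊ * 5) := by
  refine (Sim.assign_seq (Sim.assign_seq (Sim.seq_pure (sim_doubleProg (L := L) ?_ ?_ ?_)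
    (B' := 4 + (L + Nat.clog 2 n) * 5 + ⌈1 / J.pMin⌉₊ * 5) fun s₁ h₁ => ?_))).mono (fun _ _ h => h)
    (by simp only [Expr.size]; omega)
  · simp [Instance.input]
  · simp [Expr.eval]
  · simp [Expr.eval]
  obtain ⟨h6, h0, h1, h8, h15, harr⟩ := h₁
  simp [Instance.input] at h1 h8 h15 harr
  refine (Sim.seq_pure (Sim.loop_pure (x := ()) (N := L + Nat.clog 2 n) (B := 4) (R := fun k s' =>
    s'.reg 0 = n ∧ s'.reg 1 = ⌈1 / J.pMin⌉₊ ∧ s'.reg 8 = 0 ∧ s'.reg 15 = k * K ∧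
      s'.arr = s₁.arr) (by simpa [Expr.eval] using h6) ?_ ?_) fun s₂ h₂ =>
    Sim.loop_pure (N := ⌈1 / J.pMin⌉₊) (B := 4) (R := fun k s' => s'.reg 0 = n ∧
      s'.reg 8 = k * ((L + Nat.clog 2 n) * K) ∧ s'.reg 15 = (L + Nat.clog 2 n) * K ∧
      s'.arr = s₁.arr) ?_ ?_ ?_).mono ?_ (by simp only [Expr.size]; omega)
  · simp [h0, h1, h8, h15]
  · rintro k hk s' ⟨a, b, c, d, e⟩
    refine (Sim.assign ?_).mono (R := fun _ => _) (fun _ _ h => h) (by simp [Expr.size])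
    simp [Expr.eval, a, b, c, d, e]
    ring
  · simpa [Expr.eval] using h₂.2.1
  · obtain ⟨a, b, c, d, e⟩ := h₂
    simp [a, c, d, e]
  · rintro k hk s' ⟨a, b, c, d⟩
    refine (Sim.assign ?_).mono (R := fun _ => _) (fun _ _ h => h) (by simp [Expr.size])
    simp [Expr.eval, a, b, c, d]
    ring
  · rintro - s' ⟨a, b, c, d⟩
    refine ⟨List.nodup_nil, Nat.zero_le _, a, b, fun j => ?_, fun t ht => absurd ht (by simp)⟩
    rw [d, harr]
    simp [mem_remaining]

theorem sim_selectProg (q : unitInterval) (c₁ c₂ K L : ℕ) :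
    Sim J tD tM (orderLaw J q c₁ c₂ (sampleCount J K L) n) (selectProg q c₁ c₂ K L) J.input
      (fun l s => l.length = n ∧ HoldsSegment (sampleCount J K L) l s)
      (12 + n * 13 + (L + Nat.clog 2 n) * 5 + ⌈1 / J.pMin⌉₊ * 5 +
        n * (21 + n * 25 + sampleCount J K L * (tD + 8 + n * (54 + 2 * tM)))) := by
  refine (Sim.seq_pure sim_countProg fun s hs => Sim.loop (N := n)
    (law := orderLaw J q c₁ c₂ (sampleCount J K L)) (step := fun _ l =>
      (scoreLaw J q c₁ c₂ (remaining l) (sampleCount J K L)).map fun sc =>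
        extend l (pick (remaining l) sc))
    (R := fun k l s => l.length = k ∧ HoldsSegment (sampleCount J K L) l s) ?_ rfl
    (fun _ _ => rfl) ⟨rfl, hs⟩ fun k hk l s' hs' => sim_stageProg hk hs'.1 hs'.2).mono
    (fun _ _ h => h) ?_
  · simpa [Expr.eval] using hs.reg0
  · simp only [Expr.size]
    apply le_of_eq
    ring

end SelectProg

/-! ### The scheme -/

theorem Coupled.eq {X : Type} {p μ : PMF X} (h : Coupled p μ Eq) : p = μ := by
  obtain ⟨γ, h1, h2, h3⟩ := h
  rw [← h1, ← h2, ← PMF.bind_pure_comp, ← PMF.bind_pure_comp]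
  ext y
  rw [PMF.bind_apply, PMF.bind_apply]
  refine tsum_congr fun z => ?_
  by_cases hz : z ∈ γ.support
  · simp [h3 z hz]
  · simp [(PMF.apply_eq_zero_iff γ z).2 hz]

section Scheme

variable {n : ℕ} (J : Instance n) (tD tM : ℕ) (q : unitInterval) (c₁ c₂ K L : ℕ)

/-- A permutation that is stored in array `0` enumerates the complete segment stored there. -/
theorem map_finRange_eq {l : List (Fin n)} (hl : l.length = n) {m : ℕ} {s : Store}
    (h : HoldsSegment m l s) {σ : Equiv.Perm (Fin n)} (hσ : s.HoldsOrder σ) :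
    (List.finRange n).map σ = l := by
  refine List.ext_getElem (by simp [hl]) fun t h1 h2 => ?_
  have ht : t < n := by simpa using h1
  have e1 := hσ ⟨t, ht⟩
  have e2 := h.arr0 t h2
  rw [hl, Nat.sub_self, Nat.zero_add] at e2
  simp only [List.getElem_map, List.getElem_finRange]
  exact Fin.ext (e1.symm.trans e2)

theorem exists_holdsOrder {l : List (Fin n)} (hl : l.length = n) {m : ℕ} {s : Store}
    (h : HoldsSegment m l s) : ∃ σ : Equiv.Perm (Fin n), s.HoldsOrder σ := by
  have hinj : Function.Injective fun i : Fin n => l[(i : ℕ)]'(by rw [hl]; exact i.2) := by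
    intro i j hij
    exact Fin.ext ((List.Nodup.getElem_inj_iff h.nodup).1 hij)
  refine ⟨Equiv.ofBijective _ (Finite.injective_iff_bijective.1 hinj), fun i => ?_⟩
  have := h.arr0 i (by rw [hl]; exact i.2)
  simp only [hl, Nat.sub_self, Nat.zero_add] at this
  exact this

/-- The scheme with the given parameters: the order is selected by the scores, and an element that
can be selected is selected with probability `q`. -/
def scheme : Preselected where
  select := selectProg q c₁ c₂ K L
  decide := .coin 5 q
  order := by
    intro n J r hr
    obtain ⟨l, -, hl⟩ := Coupled.exists_of_mem_support
      (sim_selectProg (J := J) (tD := 0) (tM := 0) q c₁ c₂ K L) hr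
    exact exists_holdsOrder hl.1.1 hl.1.2

theorem coupled_online (A : Finset (Fin n)) (l : List (Fin n)) (s : Store) (X : Finset (Fin n)) :
    Coupled (greedyLaw J.M q A l X) (online J (.coin 5 q) A l s X)
      fun Y r => Y = r.1 ∧ r.2.time tD tM ≤ l.length * (2 + tM) := by
  classical
  induction l generalizing s X with
  | nil => exact Coupled.pure ⟨rfl, by simp [Cost.time_zero]⟩
  | cons e l ih =>
    rw [greedyLaw, online, greedyStep, PMF.bind_map]
    refine Coupled.bind (Sim.coin (tD := tD) (tM := tM)) fun b r hr => ?_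
    have hX : (if b = true ∧ e ∈ A ∧ J.M.Indep (insert e X : Finset (Fin n)) then insert e X
        else X) = if (e ∈ A ∧ J.M.Indep (insert e X : Finset (Fin n))) ∧ r.1.reg 5 ≠ 0
          then insert e X else X := by
      rw [hr.1]
      cases b <;> simp
    simp only [Function.comp_apply, hX]
    refine (ih _ _).map_right fun Y r' hr' => ⟨hr'.1, ?_⟩
    rw [Cost.time_add, Cost.time_add]
    have h1 := hr.2
    have h2 := hr'.2
    have h3 : Cost.time ⟨1, 0, 1⟩ tD tM = 1 + tM := by simp [Cost.time]
    rw [h3, List.length_cons, Nat.add_mul, Nat.one_mul]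
    omega

/-- A bound for the running time of the scheme. -/
def timeBound : ℕ :=
  12 + n * 13 + (L + Nat.clog 2 n) * 5 + ⌈1 / J.pMin⌉₊ * 5 +
    n * (21 + n * 25 + sampleCount J K L * (tD + 8 + n * (54 + 2 * tM))) + n * (2 + tM)

theorem coupled_run : Coupled (jointLaw J q c₁ c₂ (sampleCount J K L))
    ((scheme q c₁ c₂ K L).run J)
    fun ω r => ω = (r.1, r.2.1) ∧ r.2.2.time tD tM ≤ timeBound J tD tM K L := by
  classical
  refine Coupled.bind (sim_selectProg (J := J) (tD := tD) (tM := tM) q c₁ c₂ K L)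
    fun l r hr => Coupled.bind (Coupled.refl J.D) fun A A' hA => ?_
  subst hA
  have hex := exists_holdsOrder hr.1.1 hr.1.2
  rw [dif_pos hex, map_finRange_eq hr.1.1 hr.1.2 hex.choose_spec]
  refine (coupled_online J tD tM q A l r.1 ∅).map fun X r' hr' => ⟨by rw [hr'.1], ?_⟩
  rw [Cost.time_add, timeBound]
  have h2 := hr'.2
  rw [hr.1.1] at h2
  exact add_le_add hr.2 h2

theorem run_map_eq : ((scheme q c₁ c₂ K L).run J).map (fun ω => (ω.1, ω.2.1)) =
    jointLaw J q c₁ c₂ (sampleCount J K L) :=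
  (Coupled.eq ((coupled_run J 0 0 q c₁ c₂ K L).map_right fun _ _ h => h.1)).symm

theorem prob_jointLaw_active (m : ℕ) (i : Fin n) :
    prob (jointLaw J q c₁ c₂ m) {ω | i ∈ ω.1} = prob J.D {A | i ∈ A} := by
  classical
  rw [← toReal_mean_ite, ← toReal_mean_ite, jointLaw]
  simp only [mean_bind, mean_map]
  have h : ∀ (l : List (Fin n)) (A : Finset (Fin n)),
      (mean (greedyLaw J.M q A l ∅) fun _ => if i ∈ A then (1 : ℝ≥0∞) else 0) =
        if i ∈ A then 1 else 0 := fun l A => mean_const _ _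
  simp only [h, mean_const]

theorem isBalanced_jointLaw {m : ℕ} {β : ℝ} (hβ : 0 ≤ β)
    (h : ∀ i, ENNReal.ofReal β * activeProb J i ≤
      (jointLaw J q c₁ c₂ m).toOuterMeasure {ω | i ∈ ω.2 ∧ i ∈ ω.1}) :
    IsBalanced (jointLaw J q c₁ c₂ m) β := by
  intro i hi
  rw [condProb, le_div_iff₀ hi, prob_jointLaw_active]
  have h1 := h i
  rw [← ofReal_prob_active, ← ENNReal.ofReal_mul hβ, ← ofReal_prob] at h1
  exact (ENNReal.ofReal_le_ofReal_iff ENNReal.toReal_nonneg).1 h1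

end Scheme

/-! ### The choice of the parameters -/

section Parameters

variable {n : ℕ} (J : Instance n)

theorem pMin_pos (hn : 1 ≤ n) : 0 < J.pMin := by
  have : Nonempty (Fin n) := ⟨⟨0, hn⟩⟩
  obtain ⟨i, hi⟩ := exists_eq_ciInf_of_finite (f := fun i => prob J.D {A | i ∈ A})
  rw [Instance.pMin, ← hi]
  exact J.pos i

theorem pMin_le_one (hn : 1 ≤ n) : J.pMin ≤ 1 := by
  refine (pMin_le J ⟨0, hn⟩).trans ?_
  have := ENNReal.toReal_mono ENNReal.one_ne_top (activeProb_le_one J ⟨0, hn⟩)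
  rwa [ENNReal.toReal_one] at this

theorem exists_threshold {a b : ℝ} (ha : 0 ≤ a) (hab : a < b) (hb : b ≤ 1) :
    ∃ c₁ c₂ : ℕ, ∃ τ : ℝ, 0 < c₁ + c₂ ∧ (c₂ : ℝ) = τ * (c₁ + c₂) ∧ a < τ ∧ τ < b := by
  obtain ⟨r, hr1, hr2⟩ := exists_rat_btwn hab
  have hr0 : (0 : ℝ) < r := ha.trans_lt hr1
  have hr0' : 0 < r := by exact_mod_cast hr0
  have hr1' : r < 1 := by exact_mod_cast hr2.trans_le hb
  have hnum : 0 < r.num := Rat.num_pos.2 hr0'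
  have hlt : r.num < r.den := by
    have := Rat.num_lt_succ_floor_mul_den r
    have h2 := (Rat.lt_iff r 1).1 hr1'
    simpa using h2
  refine ⟨r.den - r.num.toNat, r.num.toNat, r, ?_, ?_, hr1, hr2⟩
  · omega
  · have h1 : r.num.toNat ≤ r.den := by omega
    have h2 : ((r.num.toNat : ℕ) : ℝ) = (r.num : ℝ) := by
      exact_mod_cast congrArg (Int.cast : ℤ → ℝ) (Int.toNat_of_nonneg hnum.le)
    rw [Nat.cast_sub h1, sub_add_cancel, h2]
    have h3 : (r.den : ℝ) ≠ 0 := by exact_mod_cast r.den_ne_zero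
    rw [Rat.cast_def]
    field_simp

/-- The number of samples makes the failure probability of all stages together at most `ε / 2`. -/
theorem failure_le {ε η : ℝ} {K L : ℕ} (hn : 1 ≤ n) (hε0 : 0 < ε) (hε : ε ≤ 1) (hη : 0 < η)
    (hK : 8 / η ^ 2 ≤ K) (hL : Real.log (2 / ε) ≤ L) :
    (n : ℝ) * (n * Real.exp (-(sampleCount J K L * (J.pMin * η ^ 2 / 4)))) ≤ ε / 2 := by
  have hp := pMin_pos J hn
  have hn' : (0 : ℝ) < n := by exact_mod_cast hn
  set ℓ := Nat.clog 2 n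
  have h1 : 2 * ((L : ℝ) + ℓ) ≤ sampleCount J K L * (J.pMin * η ^ 2 / 4) := by
    have hP : 1 ≤ (⌈1 / J.pMin⌉₊ : ℝ) * J.pMin := by
      have := mul_le_mul_of_nonneg_right (Nat.le_ceil (1 / J.pMin)) hp.le
      rwa [div_mul_cancel₀ 1 hp.ne'] at this
    have hK' : 2 ≤ (K : ℝ) * (η ^ 2 / 4) := by
      rw [div_le_iff₀ (by positivity)] at hK
      linarith
    have h0 : (0 : ℝ) ≤ (L : ℝ) + ℓ := by positivity
    calc 2 * ((L : ℝ) + ℓ) = 1 * ((L + ℓ) * 2) := by ring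
      _ ≤ ((⌈1 / J.pMin⌉₊ : ℝ) * J.pMin) * ((L + ℓ) * (K * (η ^ 2 / 4))) := by gcongr
      _ = _ := by
        rw [sampleCount]
        push_cast
        ring
  have h2 : Real.exp (-(L : ℝ)) ≤ ε / 2 := by
    have h3 : Real.exp (-(L : ℝ)) ≤ Real.exp (-Real.log (2 / ε)) :=
      Real.exp_le_exp.2 (by linarith)
    rw [Real.exp_neg, Real.exp_neg, Real.exp_log (by positivity), inv_div,
      ← Real.exp_neg] at h3
    exact h3
  have h3 : (n : ℝ) * Real.exp (-(ℓ : ℝ)) ≤ 1 := by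
    have h4 : (n : ℝ) ≤ 2 ^ ℓ := by exact_mod_cast Nat.le_pow_clog one_lt_two n
    have h5 : (2 : ℝ) ^ ℓ ≤ Real.exp ℓ := by
      rw [← Real.exp_one_pow]
      gcongr
      linarith [Real.add_one_le_exp 1]
    rw [Real.exp_neg, ← div_eq_mul_inv, div_le_one (Real.exp_pos _)]
    exact h4.trans h5
  calc _ ≤ (n : ℝ) * (n * Real.exp (-(2 * ((L : ℝ) + ℓ)))) := by gcongr
    _ = (n * Real.exp (-(ℓ : ℝ))) ^ 2 * Real.exp (-(L : ℝ)) ^ 2 := by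
      rw [mul_pow, ← Real.exp_nat_mul, ← Real.exp_nat_mul, mul_assoc ((n : ℝ) ^ 2), ← Real.exp_add]
      push_cast
      ring_nf
    _ ≤ 1 ^ 2 * (ε / 2) ^ 2 := by gcongr
    _ ≤ ε / 2 := by nlinarith

theorem timeBound_le {tD tM K L : ℕ} (hn : 1 ≤ n) (hD : 1 ≤ tD) (hM : 1 ≤ tM) (hK : 1 ≤ K)
    (hL : 1 ≤ L) :
    timeBound J tD tM K L ≤ 150 * (n * sampleCount J K L * (tD + tM * n)) := by
  have hP : 1 ≤ ⌈1 / J.pMin⌉₊ := Nat.one_le_ceil_iff.2 (by have := pMin_pos J hn; positivity)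
  set P := ⌈1 / J.pMin⌉₊ with hPdef
  set L' := L + Nat.clog 2 n with hL'def
  have hL' : 1 ≤ L' := by omega
  set m := sampleCount J K L with hm
  have hPm : P ≤ m := by
    rw [hm, sampleCount]
    exact Nat.le_mul_of_pos_right _ (Nat.mul_pos hL' hK)
  have hLm : L' ≤ m := by
    rw [hm, sampleCount]
    exact (Nat.le_mul_of_pos_right _ hK).trans (Nat.le_mul_of_pos_left _ hP)
  have hm1 : 1 ≤ m := hP.trans hPm
  have e1 : m ≤ n * m := Nat.le_mul_of_pos_left _ hn
  have e2 : n ≤ n * m := Nat.le_mul_of_pos_right _ hm1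
  have e3 : n * m ≤ n * m * tD := Nat.le_mul_of_pos_right _ hD
  have e4 : n * m * n ≤ n * m * (tM * n) := Nat.mul_le_mul_left _ (Nat.le_mul_of_pos_left _ hM)
  have e5 : n * n ≤ n * m * n := Nat.mul_le_mul_right _ e2
  have e6 : n * tM ≤ n * m * (tM * n) :=
    Nat.mul_le_mul e2 (Nat.le_mul_of_pos_right _ hn)
  have e7 : 1 ≤ n * m := Nat.mul_pos hn hm1
  rw [timeBound, ← hPdef, ← hL'def, ← hm]
  have e8 : n * (21 + n * 25 + m * (tD + 8 + n * (54 + 2 * tM))) = 21 * n + 25 * (n * n) +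
      n * m * tD + 8 * (n * m) + 54 * (n * m * n) + 2 * (n * m * (tM * n)) := by ring
  have e9 : n * m * (tD + tM * n) = n * m * tD + n * m * (tM * n) := by ring
  rw [e8, e9]
  have e10 : n * (2 + tM) = 2 * n + n * tM := by ring
  rw [e10]
  omega

theorem sampleCount_le {α ε : ℝ} {K L : ℕ} (hn : 1 ≤ n) (hα0 : 0 < α) (hα : α ≤ 1) (hε0 : 0 < ε)
    (hε : ε ≤ 1) (hK : (K : ℝ) ≤ 8 / (ε * α / 16) ^ 2 + 1) (hL : (L : ℝ) ≤ Real.log (2 / ε) + 2) :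
    (sampleCount J K L : ℝ) ≤
      30000 * (Real.log (2 * n / ε) / (α ^ 2 * ε ^ 2 * J.pMin)) := by
  have hp := pMin_pos J hn
  have hp1 := pMin_le_one J hn
  have hn' : (1 : ℝ) ≤ n := by exact_mod_cast hn
  have hP : (⌈1 / J.pMin⌉₊ : ℝ) ≤ 2 / J.pMin := by
    have h1 := (Nat.ceil_lt_add_one (one_div_pos.2 hp).le).le
    have h2 : 1 ≤ 1 / J.pMin := by rwa [le_div_iff₀ hp, one_mul]
    calc _ ≤ 1 / J.pMin + 1 := h1
      _ ≤ 1 / J.pMin + 1 / J.pMin := by gcongr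
      _ = _ := by ring
  have hx0 : 0 < ε * α := by positivity
  have hx1 : ε * α ≤ 1 := by nlinarith
  have hK' : (K : ℝ) ≤ 2050 / (α ^ 2 * ε ^ 2) := by
    have h2 : 1 ≤ 1 / (ε * α) ^ 2 := by
      rw [le_div_iff₀ (by positivity), one_mul]
      exact pow_le_one₀ hx0.le hx1
    calc (K : ℝ) ≤ 8 / (ε * α / 16) ^ 2 + 1 := hK
      _ ≤ 8 / (ε * α / 16) ^ 2 + 2 * (1 / (ε * α) ^ 2) := by linarith
      _ = _ := by
        field_simp
        ring
  have hlog2 : 0.69 < Real.log 2 := by linarith [Real.log_two_gt_d9]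
  have hlogn : 0 ≤ Real.log n := Real.log_nonneg hn'
  have hε2 : Real.log 2 ≤ Real.log (2 / ε) := by
    refine Real.log_le_log two_pos ?_
    rw [le_div_iff₀ hε0]
    linarith
  have hsplit : Real.log (2 * n / ε) = Real.log (2 / ε) + Real.log n := by
    rw [← Real.log_mul (by positivity) (by positivity)]
    congr 1
    ring
  have hclog : (Nat.clog 2 n : ℝ) ≤ 1.5 * Real.log n + 1 := by
    rcases Nat.lt_or_ge 1 n with h | h
    · have h1 := Nat.pow_pred_clog_lt_self one_lt_two h
      have h2 : (2 : ℝ) ^ (Nat.clog 2 n).pred ≤ n := by exact_mod_cast h1.le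
      have h3 := Real.log_le_log (by positivity) h2
      rw [Real.log_pow] at h3
      have h4 : (Nat.clog 2 n : ℝ) ≤ ((Nat.clog 2 n).pred : ℝ) + 1 := by
        exact_mod_cast Nat.le_succ_of_pred_le le_rfl
      have h5 : (0 : ℝ) ≤ ((Nat.clog 2 n).pred : ℝ) := Nat.cast_nonneg _
      nlinarith
    · rw [Nat.clog_of_right_le_one h]
      push_cast
      linarith
  have hL' : ((L + Nat.clog 2 n : ℕ) : ℝ) ≤ 6 * Real.log (2 * n / ε) := by
    rw [hsplit]
    push_cast
    linarith
  have hpos : 0 ≤ Real.log (2 * n / ε) := by rw [hsplit]; linarith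
  rw [sampleCount]
  calc ((⌈1 / J.pMin⌉₊ * ((L + Nat.clog 2 n) * K) : ℕ) : ℝ)
      = (⌈1 / J.pMin⌉₊ : ℝ) * (((L + Nat.clog 2 n : ℕ) : ℝ) * K) := by push_cast; ring
    _ ≤ 2 / J.pMin * (6 * Real.log (2 * n / ε) * (2050 / (α ^ 2 * ε ^ 2))) := by gcongr
    _ = 24600 * (Real.log (2 * n / ε) / (α ^ 2 * ε ^ 2 * J.pMin)) := by
        field_simp
        ring
    _ ≤ _ := by gcongr; norm_num

theorem balancedFor_scheme {α ε τ : ℝ} {c₁ c₂ K L : ℕ} {q : unitInterval} (hα0 : 0 < α)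
    (hα : α ≤ 1) (hε0 : 0 < ε) (hε : ε ≤ 1) (hq : (q : ℝ) = α / 2) (hc : 0 < c₁ + c₂)
    (hτ : (c₂ : ℝ) = τ * (c₁ + c₂)) (hτ₁ : α / 2 - 3 * (ε * α / 16) < τ)
    (hτ₂ : τ < α / 2 - ε * α / 16) (hK : 8 / (ε * α / 16) ^ 2 ≤ K) (hL : Real.log (2 / ε) ≤ L)
    (hJ : J.Uncontentious α) :
    (scheme q c₁ c₂ K L).BalancedFor J ((1 - ε) * α ^ 2 / 4) := by
  classical
  rw [Preselected.BalancedFor, run_map_eq]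
  rcases Nat.eq_zero_or_pos n with rfl | hn
  · exact fun i => i.elim0
  have hx0 : 0 < ε * α := by positivity
  have hx1 : ε * α ≤ α := by nlinarith
  have hstage : ∀ S : Finset (Fin n), S.Nonempty →
      (mean (scoreLaw J q c₁ c₂ S (sampleCount J K L)) fun sc =>
        if ∃ e ∈ S, pick S sc = e ∧ ENNReal.ofReal (τ - ε * α / 16) * activeProb J e ≤
          freeProb J q S e then 0 else 1) ≤ _ := fun S hS =>
    mean_pick_bad_le J q c₁ c₂ (sampleCount J K L) (η := ε * α / 16) hc (by positivity)
      (by linarith) hτ (by linarith) (by linarith) (by linarith) hJ hS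
  refine isBalanced_jointLaw J q c₁ c₂ (by have := sq_nonneg α; nlinarith) fun i => ?_
  refine le_trans ?_ (le_jointLaw J q c₁ c₂ _ hstage i)
  have hfail := failure_le J hn hε0 hε (by positivity : 0 < ε * α / 16) hK hL
  have h1 : ENNReal.ofReal (1 - ε / 2) ≤ 1 - (n : ℝ≥0∞) * (n * ENNReal.ofReal
      (Real.exp (-(sampleCount J K L * (J.pMin * (ε * α / 16) ^ 2 / 4))))) := by
    rw [ENNReal.ofReal_sub _ (by positivity), ENNReal.ofReal_one]
    refine tsub_le_tsub_left ?_ _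
    rw [← ENNReal.ofReal_natCast, ← ENNReal.ofReal_mul (Nat.cast_nonneg n),
      ← ENNReal.ofReal_mul (Nat.cast_nonneg n)]
    exact ENNReal.ofReal_le_ofReal hfail
  refine le_trans ?_ (mul_le_mul_left h1 _)
  rw [← mul_assoc, ← mul_assoc, ← ENNReal.ofReal_mul (by linarith),
    ← ENNReal.ofReal_mul (mul_nonneg (by linarith) q.2.1)]
  gcongr
  rw [hq]
  have h2 : (1 - ε / 2) * (α / 2) ≤ τ - ε * α / 16 := by linarith
  have h3 : 0 ≤ (1 - ε / 2) * (α / 2) := mul_nonneg (by linarith) (by linarith)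
  calc (1 - ε) * α ^ 2 / 4 ≤ ((1 - ε / 2) * (α / 2)) * ((1 - ε / 2) * (α / 2)) := by
        nlinarith [mul_nonneg (sq_nonneg ε) (sq_nonneg α)]
    _ ≤ _ := by gcongr

end Parameters

end OCRS

end

theorem mainTheorem5 :
    ∃ C : ℝ, 0 < C ∧ ∀ α ε : ℝ, 0 < α → α ≤ 1 → 0 < ε → ε ≤ 1 →
      ∃ alg : OCRS.Preselected,
        alg.IsUniversal α ((1 - ε) * α ^ 2 / 4) ∧
        ∀ n : ℕ, 1 ≤ n → ∀ J : OCRS.Instance n, J.Uncontentious α →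
          ∀ tD tM : ℕ, 1 ≤ tD → 1 ≤ tM →
            alg.RunsInTime J tD tM
              (C * (n * Real.log (2 * n / ε) / (α ^ 2 * ε ^ 2 * J.pMin) * (tD + tM * n))) := by
  refine ⟨150 * 30000, by norm_num, fun α ε hα0 hα hε0 hε => ?_⟩
  have hx0 : 0 < ε * α := by positivity
  have hx1 : ε * α ≤ α := by nlinarith
  obtain ⟨c₁, c₂, τ, hc, hτ, hτ₁, hτ₂⟩ := OCRS.exists_threshold
    (a := α / 2 - 3 * (ε * α / 16)) (b := α / 2 - ε * α / 16) (by linarith) (by linarith)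
    (by linarith)
  set K := ⌈8 / (ε * α / 16) ^ 2⌉₊
  set L := ⌈Real.log (2 / ε)⌉₊ + 1
  have hlog : 0 ≤ Real.log (2 / ε) := by
    refine Real.log_nonneg ?_
    rw [le_div_iff₀ hε0]
    linarith
  have hK0 : 0 ≤ 8 / (ε * α / 16) ^ 2 := by positivity
  have hK1 : 1 ≤ K := Nat.one_le_ceil_iff.2 (by positivity)
  have hL₁ : Real.log (2 / ε) ≤ L := (Nat.le_ceil _).trans (by push_cast [L]; linarith)
  have hL₂ : (L : ℝ) ≤ Real.log (2 / ε) + 2 := by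
    have := (Nat.ceil_lt_add_one hlog).le
    push_cast [L]
    linarith
  refine ⟨OCRS.scheme ⟨α / 2, by linarith, by linarith⟩ c₁ c₂ K L, fun n J hJ =>
    OCRS.balancedFor_scheme J hα0 hα hε0 hε rfl hc hτ hτ₁ hτ₂ (Nat.le_ceil _) hL₁ hJ, ?_⟩
  intro n hn J _ tD tM hD hM ω hω
  obtain ⟨_, -, -, hT⟩ := (OCRS.coupled_run J tD tM _ c₁ c₂ K L).exists_of_mem_support hω
  have h1 : (ω.2.2.time tD tM : ℝ) ≤
      150 * (n * OCRS.sampleCount J K L * (tD + tM * n)) := by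
    exact_mod_cast hT.trans (OCRS.timeBound_le J hn hD hM hK1 (Nat.le_add_left 1 _))
  have h2 := OCRS.sampleCount_le J hn hα0 hα hε0 hε (Nat.ceil_lt_add_one hK0).le hL₂
  refine h1.trans ?_
  calc _ ≤ 150 * (n * (30000 * (Real.log (2 * n / ε) / (α ^ 2 * ε ^ 2 * J.pMin))) *
        ((tD : ℝ) + tM * n)) := by gcongr
    _ = _ := by ring
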